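/- **Arrays.** An array with $n$ columns and $m$ rows is a family of non-negative reals $a(i,j)$, $1\le i\le n$ (column), $1\le j\le m$ (row, counted from the bottom). Put $\left(\int\!\!\int a\right)(i,j)=\sum_{i'\le i,\,j'\le j}a(i',j')$, let $(*a)(i,j)=a(n+1-i,m+1-j)$, let $a^T$ be the transposed array, and let $a\otimes b$ be the concatenation (the columns of $a$ followed by those of $b$). For a tuple $p=(p_1,\dots,p_n)$ put $\left(\int p\right)(j)=\sum_{k\le j}p_k$, $|p|=\sum_k p_k$, $p^{op}=(p_n,\dots,p_1)$, and let $\mathrm{diag}(p)$ be the $n\times n$ array with $p_i$ at $(i,i)$ and $0$ elsewhere. For $1\le j\le m-1$ and $0\le i\le n$ put $\beta_i=\sum_{k\le i}a(k,j+1)-\sum_{k<i}a(k,j)$ (so $\beta_0=0$). If $\max\beta=0$, then $D_ja=a$; otherwise let $s\geq 1$ be the first index at which $\beta$ is maximal: $D_j$ moves the mass $\min\left(1,\beta_s-\max_{i<s}\beta_i\right)$ from the box $(s,j+1)$ down to $(s,j)$. $\mathbf D_j$ is $D_j$ iterated until it stabilizes, $\mathbf D=(\mathbf D_1\cdots\mathbf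 D_{m-1})^m$, $\mathbf L(a)=(\mathbf D(a^T))^T$ and $\mathbf R(a)=*\,\mathbf L(*a)$ (condensations downwards, to the left and to the right). **Discrete concave functions.** Let $\lambda,\mu,\nu$ be decreasing $n$-tuples of non-negative reals and let $f\in DC_n(\lambda,\mu,\nu)$ with $f(0,0)=0$: $f$ is a real function on $\Delta_n=\{(i,j)\in\mathbb Z^2: 0\le i\le j\le n\}$ which satisfies $$f(i,j)+f(i+1,j+1)\ge f(i+1,j)+f(i,j+1),$$ $$f(i,j+1)+f(i+1,j+1)\ge f(i+1,j+2)+f(i,j),$$ $$f(i+1,j)+f(i+1,j+1)\ge f(i,j)+f(i+2,j+1)$$ whenever the four points lie in $\Delta_n$, and $f(0,k)-f(0,k-1)=\lambda_k$, $f(k,n)-f(k-1,n)=\mu_k$, $f(k,k)-f(k-1,k-1)=\nu_k$ for $1\le k\le n$. Extend $f$ to $[0,n]^2$ by $f(i,j)=f(j,j)$ for $i>j$; let $b=\partial\partial f$ be the $n\times n$ array $b(i,j)=f(i,j)-f(i-1,j)-f(i,j-1)+f(i-1,j-1)$, and let $(*f)(i,j)=f(n-i,n-j)$. Let $a=\mathbf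 R(\mathrm{diag}(\lambda))$. The commuter of $f$ is the function on $\Delta_n$ $$Com'(f)(i,j)=\left(\int\!\!\int \mathbf D(*(a\otimes b))\right)(n+i,j),$$ and $h$ is the function on $\Delta_n$ $$h(i,j)=\left(\int\!\!\int\mathbf L(*b)\right)(i,j)-\left(\int\nu^{op}\right)(j)+|\nu| .$$ **Octahedron recurrence.** It has the propagation vector $(1,0,1)$: for a point $p=(x,y,z)$ put $\mathbf 0=p$, $\mathbf 1=p+(1,0,1)$, $\alpha=p-(0,1,0)$, $\alpha'=p+(1,1,1)$, $\gamma=p+(1,0,0)$, $\gamma'=p+(0,0,1)$; then $$F(\mathbf 1)=\max\left(F(\alpha)+F(\alpha'),\,F(\gamma)+F(\gamma')\right)-F(\mathbf 0).$$ On the quarter of the octahedron $T=OD'B'C'=\{0\le y\le z\le x\le n\}$, with $O=(0,0,0)$, $C'=(n,0,0)$, $D'=(n,0,n)$, $B'=(n,n,n)$, the rule is truncated when a point lies outside $T$: $F(\mathbf 1)=F(\gamma)+F(\gamma')-F(\mathbf 0)$ if only $\alpha\notin T$, $F(\mathbf 1)=F(\alpha)+F(\alpha')-F(\mathbf 0)$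 if only $\gamma'\notin T$, and $F(\mathbf 1)=F(\gamma)+F(\alpha')-F(\mathbf 0)$ if both are outside $T$. On the prism $P=\{0\le x\le n,\ 0\le y\le z\le n\}$ only the rule on the wall $y=0$ is truncated, by $F(\mathbf 1)=F(\gamma)+F(\gamma')-F(\mathbf 0)$. **Proposition 4.** 1) There is exactly one function $F$ on $T$ that satisfies the octahedron recurrence on $T$ and equals $*f$ on the face $OB'C'$, i.e. $F(i,j,j)=(*f)(i,j)$ for $0\le j\le i\le n$. It is the restriction to $T$ of the function $G$ that the octahedron recurrence on $P$ produces from the data $G(i,j,j)=(*f)(i,j)$ for $0\le i,j\le n$ and $G(0,y,z)=(*f)(0,z)$ for $0\le y\le z\le n$. On the face $C'D'B'$ it equals $h$ up to an additive constant: there is a constant $c$ with $h(i,j)=F(n,i,j)+c$ for all $0\le i\le j\le n$. 2) $h$ is $Com'(f)$ rotated by $120^\circ$: $h(i,j)=Com'(f)(n-j,\,n-j+i)$ for all $0\le i\le j\le n$. -/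

import Mathlib

/-! Arrays.  An array with `n` columns and `m` rows is a function `a : ℕ → ℕ → ℝ` of which only
the values `a i j` with `1 ≤ i ≤ n` (column) and `1 ≤ j ≤ m` (row, counted from the bottom) are
meaningful.  A tuple `p` of length `n` is a function `ℕ → ℝ` read on `1 ≤ k ≤ n`. -/

noncomputable section

namespace OctArray

/-- `∫∫ a`: the mass of all boxes to the south-west of the point `(i, j)`. -/
def dint (a : ℕ → ℕ → ℝ) (i j : ℕ) : ℝ :=
  ∑ k ∈ Finset.Icc 1 i, ∑ l ∈ Finset.Icc 1 j, a k l

/-- `∫ p`: the partial sums of a tuple. -/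
def tint (p : ℕ → ℝ) (j : ℕ) : ℝ := ∑ k ∈ Finset.Icc 1 j, p k

/-- The reversed tuple `p^op = (p_n, …, p_1)`. -/
def rev (n : ℕ) (p : ℕ → ℝ) (k : ℕ) : ℝ := p (n + 1 - k)

/-- Partitions: decreasing tuples of non-negative reals. -/
def IsPartition (n : ℕ) (p : ℕ → ℝ) : Prop :=
  (∀ k, 1 ≤ k → k < n → p (k + 1) ≤ p k) ∧ ∀ k, 1 ≤ k → k ≤ n → 0 ≤ p k

/-- Transposition of an array. -/
def transp (a : ℕ → ℕ → ℝ) (i j : ℕ) : ℝ := a j i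

/-- The central symmetry `*` on arrays with `n` columns and `m` rows. -/
def star (n m : ℕ) (a : ℕ → ℕ → ℝ) (i j : ℕ) : ℝ := a (n + 1 - i) (m + 1 - j)

/-- The concatenation `a ⊗ b`: first the `n` columns of `a`, then the columns of `b`. -/
def concat (n : ℕ) (a b : ℕ → ℕ → ℝ) (i j : ℕ) : ℝ :=
  if i ≤ n then a i j else b (i - n) j

/-- The diagonal array `diag(p)`. -/
def diag (p : ℕ → ℝ) (i j : ℕ) : ℝ := if i = j then p i else 0

/-- `β_i = a(1,j+1) + … + a(i,j+1) - a(1,j) - … - a(i-1,j)`, with `β_0 = 0`. -/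
def beta (j : ℕ) (a : ℕ → ℕ → ℝ) (i : ℕ) : ℝ :=
  ∑ k ∈ Finset.Icc 1 i, a k (j + 1) - ∑ k ∈ Finset.Ico 1 i, a k j

/-- `max (β_0, …, β_i)`. -/
def prefMax (j : ℕ) (a : ℕ → ℕ → ℝ) (i : ℕ) : ℝ :=
  (Finset.range (i + 1)).sup' Finset.nonempty_range_add_one (beta j a)

/-- The smallest `i` in `{0, …, n}` at which `β` attains its maximum. -/
def argMax (n j : ℕ) (a : ℕ → ℕ → ℝ) : ℕ :=
  sInf {i | i ≤ n ∧ beta j a i = prefMax j a n}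

/-- The operation `D_j` on arrays with `n` columns.  If `β` is maximal at `0` nothing happens.
Otherwise, `i` being the first place where `β` is maximal, a mass at most `1` moves down from the
box `(i, j+1)` to the box `(i, j)`, as much as possible as long as `i` keeps `β` maximal (so
exactly `1` when the array is integer-valued). -/
def opD (n j : ℕ) (a : ℕ → ℕ → ℝ) : ℕ → ℕ → ℝ :=
  let s := argMax n j a
  if s = 0 then a
  else
    let t := min 1 (prefMax j a n - prefMax j a (s - 1))
    fun i l =>
      if i = s ∧ l = j + 1 then a i l - t
      else if i = s ∧ l = j then a i l + t
      else a i l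

/-- `𝐃_j`: the operation `D_j` iterated until it stabilizes. -/
def bigD (n j : ℕ) (a : ℕ → ℕ → ℝ) : ℕ → ℕ → ℝ :=
  (opD n j)^[sInf {e | (opD n j)^[e + 1] a = (opD n j)^[e] a}] a

/-- The product `𝐃_1 𝐃_2 ⋯ 𝐃_r` (the rightmost factor acts first). -/
def prodD (n : ℕ) : ℕ → (ℕ → ℕ → ℝ) → ℕ → ℕ → ℝ
  | 0, a => a
  | r + 1, a => prodD n r (bigD n (r + 1) a)

/-- The condensation `𝐃 = (𝐃_1 ⋯ 𝐃_{m-1})^m` of arrays with `n` columns and `m` rows. -/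
def condD (n m : ℕ) (a : ℕ → ℕ → ℝ) : ℕ → ℕ → ℝ := (prodD n (m - 1))^[m] a

/-- The condensation `𝐋` to the left: transpose, apply `𝐃`, transpose back. -/
def condL (n m : ℕ) (a : ℕ → ℕ → ℝ) : ℕ → ℕ → ℝ := transp (condD m n (transp a))

/-- The condensation `𝐑` to the right: the conjugate of `𝐋` by the central symmetry. -/
def condR (n m : ℕ) (a : ℕ → ℕ → ℝ) : ℕ → ℕ → ℝ := star n m (condL n m (star n m a))

/-- `f ∈ DC_n(λ, μ, ν)`, normalized by `f(0,0) = 0`: `f` is a discrete concave function on the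
triangular grid `{(i, j) : 0 ≤ i ≤ j ≤ n}` with increments `λ` on the left side, `μ` on the top
side and `ν` on the hypotenuse. -/
structure IsDC (n : ℕ) (lam mu nu : ℕ → ℝ) (f : ℕ → ℕ → ℝ) : Prop where
  rhombus₁ : ∀ i j, i + 1 ≤ j → j + 1 ≤ n →
    f (i + 1) j + f i (j + 1) ≤ f i j + f (i + 1) (j + 1)
  rhombus₂ : ∀ i j, i ≤ j → j + 2 ≤ n →
    f (i + 1) (j + 2) + f i j ≤ f i (j + 1) + f (i + 1) (j + 1)
  rhombus₃ : ∀ i j, i + 1 ≤ j → j + 1 ≤ n →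
    f i j + f (i + 2) (j + 1) ≤ f (i + 1) j + f (i + 1) (j + 1)
  zero : f 0 0 = 0
  left : ∀ k, k < n → f 0 (k + 1) - f 0 k = lam (k + 1)
  top : ∀ k, k < n → f (k + 1) n - f k n = mu (k + 1)
  hyp : ∀ k, k < n → f (k + 1) (k + 1) - f k k = nu (k + 1)

/-- The extension of a function on the triangle to the square `[0,n] × [0,n]`, constant along
each row to the right of the hypotenuse. -/
def ext (f : ℕ → ℕ → ℝ) (i j : ℕ) : ℝ := f (min i j) j

/-- The `𝐋`-tight array `b = ∂∂f` of mixed derivatives of a discrete concave function. -/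
def mixed (f : ℕ → ℕ → ℝ) (i j : ℕ) : ℝ :=
  ext f i j - ext f (i - 1) j - ext f i (j - 1) + ext f (i - 1) (j - 1)

/-- The function `*f` (on the square `[0,n] × [0,n]`): `f` turned over.  On the triangle
`j ≤ i ≤ n` it is `f (n - i) (n - j)`. -/
def starF (n : ℕ) (f : ℕ → ℕ → ℝ) (i j : ℕ) : ℝ := ext f (n - i) (n - j)

/-- The commuter on functions: `f` corresponds to the anti-standard pair `(a, b)` with
`a = 𝐑(diag λ)` and `b = ∂∂f`; `Com(a, b) = 𝐃(*(a ⊗ b))` is a concatenation `b' ⊗ a'`, and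
`Com'(f)` is the restriction of `∫∫(b' ⊗ a')` to the triangle `n ≤ x ≤ n + y`, `y ≤ n`. -/
def comF (n : ℕ) (lam : ℕ → ℝ) (f : ℕ → ℕ → ℝ) (i j : ℕ) : ℝ :=
  dint (condD (2 * n) n (star (2 * n) n (concat n (condR n n (diag lam)) (mixed f)))) (n + i) j

/-- The function `h = ∫∫ 𝐋(*b) - ∫_z ν^op + |ν|`, where `b = ∂∂f`. -/
def hF (n : ℕ) (nu : ℕ → ℝ) (f : ℕ → ℕ → ℝ) (i j : ℕ) : ℝ :=
  dint (condL n n (star n n (mixed f))) i j - tint (rev n nu) j + tint nu n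

/-- The octahedron recurrence with propagation vector `(1,0,1)` on the prism
`0 ≤ x ≤ n`, `0 ≤ y ≤ z ≤ n`.  The primitive octahedron at `p` has the pairs of antipodal
vertices `p, p+(1,0,1)`, then `p-(0,1,0), p+(1,1,1)`, and `p+(1,0,0), p+(0,0,1)`; on the wall
`y = 0` the second pair is absent. -/
structure IsPrismOR (n : ℕ) (F : ℕ → ℕ → ℕ → ℝ) : Prop where
  inner : ∀ x y z, y + 1 ≤ z → z < n → x < n →
    F (x + 1) (y + 1) (z + 1) =
      max (F x y z + F (x + 1) (y + 2) (z + 1)) (F (x + 1) (y + 1) z + F x (y + 1) (z + 1))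
        - F x (y + 1) z
  wall : ∀ x z, z < n → x < n →
    F (x + 1) 0 (z + 1) = F (x + 1) 0 z + F x 0 (z + 1) - F x 0 z

/-- The octahedron recurrence on the quarter of the octahedron (the tetrahedron
`0 ≤ y ≤ z ≤ x ≤ n` with vertices `O = (0,0,0)`, `C' = (n,0,0)`, `D' = (n,0,n)`,
`B' = (n,n,n)`), with the same propagation vector.  The octahedra cut by one of the walls `y = 0`,
`z = x` keep one complete pair of antipodal vertices besides the propagation diagonal; those cut
by both (along `OD'`) keep one vertex of each pair. -/
structure IsQuarterOR (n : ℕ) (F : ℕ → ℕ → ℕ → ℝ) : Prop where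
  inner : ∀ x y z, y + 1 ≤ z → z < x → x < n →
    F (x + 1) (y + 1) (z + 1) =
      max (F x y z + F (x + 1) (y + 2) (z + 1)) (F (x + 1) (y + 1) z + F x (y + 1) (z + 1))
        - F x (y + 1) z
  wall_y : ∀ x z, z < x → x < n →
    F (x + 1) 0 (z + 1) = F (x + 1) 0 z + F x 0 (z + 1) - F x 0 z
  wall_zx : ∀ x y, y + 1 ≤ x → x < n →
    F (x + 1) (y + 1) (x + 1) = F x y x + F (x + 1) (y + 2) (x + 1) - F x (y + 1) x
  edge : ∀ x, x < n →
    F (x + 1) 0 (x + 1) = F (x + 1) 0 x + F (x + 1) 1 (x + 1) - F x 0 x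

end OctArray

end

namespace OctArray

/-! An array is recorded by its levels `i ↦ dint a i j`. On levels, `bigD` at row `j` replaces level
`j` by its octahedron propagation `lift` between the levels `j - 1` and `j + 1` (`tower_bigD`).
These operators satisfy the 0-Hecke relations (`isHecke_raise`), so 𝐃, a power of the product of all
generators, equals the staircase product of the longest element (`IsHecke.sweep_pow`). Unfolding the
staircase sweep by sweep shows that `oct` obeys the octahedron recurrence (`oct_rec`), with `dint a`
on `y = z` and `0` on `y = 0`.

The recurrence is symmetric in `x` and `z`. For a non-negative array so are its boundary values,
hence transposing the array exchanges `x` and `z` (`oct_transp`), and the same function computes 𝐋.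

Take the array `*b`. Its `dint` is `*f` up to a function of `x` plus a function of `z`, which the
recurrence does not see; this gives `prism`. The rhombus inequalities make `*b` tight to the right,
so on the wall `z = x` the column sums determine `oct` (`oct_of_tight_right`), and the truncated
rules follow. On `x = n` one reads 𝐋(`*b`), hence `h`.

For the commuter, `*(a ⊗ b)` is `*b` followed by 𝐋(`*diag(λ)`). Beyond `x = n`, `IsDC.oct_slope`
settles every maximum, and up to an explicit function the values travel unchanged along `(1,1,1)`
from the slice `x = n` to the slice `z = n` (`IsDC.oct_pairArray`). This transport is the rotation.
-/

/-! ### Staircase products under the `0`-Hecke relations -/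

section Hecke

variable {M : Type*} [Monoid M] (τ : ℕ → M)

/-- The relations of the `0`-Hecke monoid of type `A`. -/
structure IsHecke : Prop where
  idem : ∀ i, τ i * τ i = τ i
  comm : ∀ i j, i + 2 ≤ j → τ i * τ j = τ j * τ i
  braid : ∀ i, τ i * τ (i + 1) * τ i = τ (i + 1) * τ i * τ (i + 1)

/-- `τ 0 * τ 1 * ⋯ * τ (k - 1)`. -/
def sweep : ℕ → M
  | 0 => 1
  | k + 1 => sweep k * τ k

/-- `sweep (m - 1) * ⋯ * sweep 1 * sweep 0`. -/
def stair : ℕ → M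
  | 0 => 1
  | m + 1 => sweep τ m * stair m

variable {τ}

theorem IsHecke.sweep_comm (h : IsHecke τ) {k j : ℕ} (hkj : k + 1 ≤ j) :
    sweep τ k * τ j = τ j * sweep τ k := by
  induction k with
  | zero => simp [sweep]
  | succ k ih =>
    rw [sweep, mul_assoc, h.comm k j hkj, ← mul_assoc, ih (by omega), mul_assoc]

theorem IsHecke.stair_comm (h : IsHecke τ) {m j : ℕ} (hmj : m ≤ j) :
    stair τ m * τ j = τ j * stair τ m := by
  induction m with
  | zero => simp [stair]
  | succ m ih =>
    rw [stair, mul_assoc, ih (by omega), ← mul_assoc, h.sweep_comm hmj, mul_assoc]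

theorem IsHecke.sweep_sweep_mul (h : IsHecke τ) (k : ℕ) :
    sweep τ (k + 1) * sweep τ k * τ k = sweep τ (k + 1) * sweep τ k := by
  induction k with
  | zero => simp [sweep, h.idem]
  | succ k ih =>
    have key : sweep τ (k + 2) * sweep τ (k + 1)
        = sweep τ (k + 1) * sweep τ k * (τ (k + 1) * τ k) := by
      calc sweep τ (k + 2) * sweep τ (k + 1)
          = sweep τ (k + 1) * τ (k + 1) * (sweep τ k * τ k) := rfl
        _ = sweep τ (k + 1) * (τ (k + 1) * sweep τ k) * τ k := by simp only [mul_assoc]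
        _ = _ := by rw [← h.sweep_comm (le_refl _)]; simp only [mul_assoc]
    rw [key, mul_assoc, ← h.braid k]
    calc sweep τ (k + 1) * sweep τ k * (τ k * τ (k + 1) * τ k)
        = sweep τ (k + 1) * sweep τ k * τ k * (τ (k + 1) * τ k) := by simp only [mul_assoc]
      _ = _ := by rw [ih]

/-- The staircase is the longest element, so it absorbs generators on either side. This side removes
the surplus letters in `IsHecke.sweep_pow`; `IsHecke.mul_stair` says that a condensed array is
tight. -/
theorem IsHecke.stair_mul (h : IsHecke τ) {m i : ℕ} (hi : i + 1 < m) :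
    stair τ m * τ i = stair τ m := by
  induction m with
  | zero => omega
  | succ m ih =>
    rcases Nat.lt_or_ge (i + 1) m with h1 | h1
    · rw [stair, mul_assoc, ih h1]
    · obtain rfl : m = i + 1 := by omega
      rw [stair, stair, mul_assoc, mul_assoc, h.stair_comm (le_refl i), ← mul_assoc, ← mul_assoc,
        h.sweep_sweep_mul, mul_assoc]

theorem IsHecke.mul_sweep (h : IsHecke τ) {k i : ℕ} (hi : i + 1 < k) :
    τ (i + 1) * sweep τ k = sweep τ k * τ i := by
  induction k with
  | zero => omega
  | succ k ih =>
    rcases Nat.lt_or_ge (i + 1) k with h1 | h1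
    · rw [sweep, ← mul_assoc, ih h1, mul_assoc, h.comm i k h1, mul_assoc]
    · obtain rfl : k = i + 1 := by omega
      rw [sweep, sweep, ← mul_assoc, ← mul_assoc, ← h.sweep_comm (le_refl _), mul_assoc, mul_assoc,
        ← mul_assoc (τ (i + 1)), ← h.braid]
      simp only [mul_assoc]

theorem IsHecke.zero_mul_sweep (h : IsHecke τ) {k : ℕ} (hk : 0 < k) :
    τ 0 * sweep τ k = sweep τ k := by
  induction k with
  | zero => omega
  | succ k ih =>
    rcases Nat.eq_zero_or_pos k with rfl | h1
    · simp [sweep, h.idem]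
    · rw [sweep, ← mul_assoc, ih h1]

theorem IsHecke.mul_stair (h : IsHecke τ) {m i : ℕ} (hi : i + 1 < m) :
    τ i * stair τ m = stair τ m := by
  induction m generalizing i with
  | zero => omega
  | succ m ih =>
    rw [stair, ← mul_assoc]
    cases i with
    | zero => rw [h.zero_mul_sweep (by omega)]
    | succ i => rw [h.mul_sweep (by omega), mul_assoc, ih (by omega)]

theorem sweep_eq_mul {l m : ℕ} (hlm : l ≤ m) :
    ∃ U ∈ Submonoid.closure {x | ∃ i, l ≤ i ∧ i < m ∧ x = τ i}, sweep τ m = sweep τ l * U := by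
  induction m, hlm using Nat.le_induction with
  | base => exact ⟨1, one_mem _, (mul_one _).symm⟩
  | succ m hm ih =>
    obtain ⟨U, hU, h⟩ := ih
    refine ⟨U * τ m, mul_mem (Submonoid.closure_mono ?_ hU)
      (Submonoid.subset_closure ⟨m, hm, by omega, rfl⟩), by rw [sweep, h, mul_assoc]⟩
    rintro x ⟨i, h1, h2, rfl⟩
    exact ⟨i, h1, by omega, rfl⟩

/-- Each new full sweep contributes its initial segment to the staircase prefix `V`; the remaining
letters have high index and are pushed into `U`. -/
theorem IsHecke.sweep_pow_eq_mul (h : IsHecke τ) {m k : ℕ} (hk : k ≤ m + 1) :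
    ∃ V, V * stair τ (m + 1 - k) = stair τ (m + 1) ∧
      ∃ U ∈ Submonoid.closure {x | ∃ i, m + 1 ≤ i + k ∧ i < m ∧ x = τ i},
        sweep τ m ^ k = V * U := by
  induction k with
  | zero => exact ⟨1, by simp, 1, one_mem _, by simp⟩
  | succ k ih =>
    obtain ⟨V, hV, U, hU, hVU⟩ := ih (by omega)
    obtain ⟨Q, hQ, hsw⟩ := sweep_eq_mul (τ := τ) (show m - k ≤ m by omega)
    refine ⟨V * sweep τ (m - k), ?_, U * Q, mul_mem (Submonoid.closure_mono ?_ hU)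
      (Submonoid.closure_mono ?_ hQ), ?_⟩
    · rw [mul_assoc, ← hV, show m + 1 - k = (m - k) + 1 by omega, stair,
        show m + 1 - (k + 1) = m - k by omega]
    · rintro x ⟨i, h1, h2, rfl⟩
      exact ⟨i, by omega, h2, rfl⟩
    · rintro x ⟨i, h1, h2, rfl⟩
      exact ⟨i, by omega, h2, rfl⟩
    -- Letters of `U` have index at least `m - k + 1`, while those of the sweep stop at `m - k - 1`.
    · have hc : U * sweep τ (m - k) = sweep τ (m - k) * U := by
        clear hVU
        induction hU using Submonoid.closure_induction with
        | mem x hx =>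
          obtain ⟨i, h1, h2, rfl⟩ := hx
          exact (h.sweep_comm (by omega)).symm
        | one => simp
        | mul x y _ _ hx hy => rw [mul_assoc, hy, ← mul_assoc, hx, mul_assoc]
      rw [pow_succ, hVU, hsw, mul_assoc, ← mul_assoc U, hc]
      simp only [mul_assoc]

theorem IsHecke.sweep_pow (h : IsHecke τ) (m : ℕ) : sweep τ m ^ (m + 1) = stair τ (m + 1) := by
  obtain ⟨V, hV, U, hU, hVU⟩ := h.sweep_pow_eq_mul (le_refl (m + 1))
  rw [Nat.sub_self, stair, mul_one] at hV
  rw [hVU, hV]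
  clear hVU
  induction hU using Submonoid.closure_induction with
  | mem x hx =>
    obtain ⟨i, -, h2, rfl⟩ := hx
    exact h.stair_mul (by omega)
  | one => simp
  | mul x y _ _ hx hy => rw [← mul_assoc, hx, hy]

end Hecke

/-! ### Raising a level of a tower of functions -/

/-- The propagation of `q` between its neighbours `p` and `r` by the two-dimensional octahedron
rule. -/
noncomputable def lift (p q r : ℕ → ℝ) : ℕ → ℝ
  | 0 => q 0
  | x + 1 => max (lift p q r x + q (x + 1)) (r (x + 1) + p x) - q x

theorem le_lift (p q r : ℕ → ℝ) (x : ℕ) : q x ≤ lift p q r x := by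
  induction x with
  | zero => exact le_refl _
  | succ x ih =>
    rw [lift]
    linarith [le_max_left (lift p q r x + q (x + 1)) (r (x + 1) + p x)]

theorem sub_le_lift_sub (p q r : ℕ → ℝ) (x : ℕ) :
    q (x + 1) - q x ≤ lift p q r (x + 1) - lift p q r x := by
  rw [lift]
  linarith [le_max_left (lift p q r x + q (x + 1)) (r (x + 1) + p x)]

theorem add_le_lift_add (p q r : ℕ → ℝ) (x : ℕ) :
    r (x + 1) + p x ≤ lift p q r (x + 1) + q x := by
  rw [lift]
  linarith [le_max_right (lift p q r x + q (x + 1)) (r (x + 1) + p x)]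

theorem lift_eq_self {p q r : ℕ → ℝ} {n : ℕ}
    (h : ∀ x, x < n → r (x + 1) + p x ≤ q (x + 1) + q x) {x : ℕ} (hx : x ≤ n) :
    lift p q r x = q x := by
  induction x with
  | zero => rfl
  | succ x ih =>
    rw [lift, ih (by omega), max_eq_left (by linarith [h x (by omega)])]
    ring

theorem lift_lift (p q r : ℕ → ℝ) : lift p (lift p q r) r = lift p q r := by
  funext x
  refine lift_eq_self (n := x) (fun y _ => ?_) le_rfl
  linarith [add_le_lift_add p q r y, le_lift p q r y]

/-- The first two clauses are the braid relation. The third, an octahedron relation among the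
intermediate levels, is what closes the induction on `x`. -/
theorem lift_braid (p q r s : ℕ → ℝ) (x : ℕ) :
    lift p (lift p q r) (lift (lift p q r) r s) x = lift p q (lift q r s) x ∧
    lift (lift p q r) r s x = lift (lift p q (lift q r s)) (lift q r s) s x ∧
    lift p q r x + lift q r s x =
      max (q x + lift (lift p q r) r s x) (r x + lift p q (lift q r s) x) := by
  induction x with
  | zero => simp [lift, add_comm]
  | succ x ih =>
    obtain ⟨h1, h2, h3⟩ := ih
    simp only [lift]
    rw [← h2, h1]
    generalize lift (lift p q r) r s x = r1 at *
    generalize lift p q (lift q r s) x = q2 at *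
    generalize lift p q r x = q1 at *
    generalize lift q r s x = r2 at *
    generalize p x = p0, q x = q0, r x = r0, s x = s0, q (x + 1) = q', r (x + 1) = r',
      s (x + 1) = s' at *
    clear h1 h2
    refine ⟨?_, ?_, ?_⟩ <;> grind

/-- The operator which raises the level `i + 1` of a tower `φ` of functions. -/
noncomputable def raise (i : ℕ) : Function.End (ℕ → ℕ → ℝ) := fun φ =>
  Function.update φ (i + 1) (lift (φ i) (φ (i + 1)) (φ (i + 2)))

theorem raise_self (i : ℕ) (φ : ℕ → ℕ → ℝ) :
    raise i φ (i + 1) = lift (φ i) (φ (i + 1)) (φ (i + 2)) := Function.update_self ..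

theorem raise_of_ne {i y : ℕ} (h : y ≠ i + 1) (φ : ℕ → ℕ → ℝ) : raise i φ y = φ y :=
  Function.update_of_ne h ..

theorem isHecke_raise : IsHecke raise where
  idem i := by
    funext φ y
    change raise i (raise i φ) y = _
    by_cases h : y = i + 1
    · subst h
      rw [raise_self, raise_self, raise_of_ne (by omega), raise_of_ne (by omega), lift_lift]
    · rw [raise_of_ne h]
  comm i j hij := by
    funext φ y
    change raise i (raise j φ) y = raise j (raise i φ) y
    by_cases h : y = i + 1
    · subst h
      simp only [raise_self, raise_of_ne (show i + 1 ≠ j + 1 by omega),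
        raise_of_ne (show i ≠ j + 1 by omega), raise_of_ne (show i + 2 ≠ j + 1 by omega)]
    · rw [raise_of_ne h]
      by_cases h' : y = j + 1
      · subst h'
        simp only [raise_self, raise_of_ne (show j ≠ i + 1 by omega), raise_of_ne h,
          raise_of_ne (show j + 2 ≠ i + 1 by omega)]
      · rw [raise_of_ne h', raise_of_ne h', raise_of_ne h]
  braid i := by
    funext φ y
    change raise i (raise (i + 1) (raise i φ)) y = raise (i + 1) (raise i (raise (i + 1) φ)) y
    by_cases h : y = i + 1
    · subst h
      funext x
      simp only [raise_self, raise_of_ne (show i ≠ i + 1 by omega),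
        raise_of_ne (show i + 2 ≠ i + 1 by omega), raise_of_ne (show i ≠ i + 1 + 1 by omega),
        raise_of_ne (show i + 1 ≠ i + 1 + 1 by omega), raise_of_ne (show i + 3 ≠ i + 1 by omega)]
      exact (lift_braid ..).1
    · by_cases h' : y = i + 2
      · subst h'
        funext x
        simp only [raise_self, raise_of_ne (show i + 2 ≠ i + 1 by omega),
          raise_of_ne (show i ≠ i + 1 + 1 by omega),
          raise_of_ne (show i + 1 ≠ i + 1 + 1 by omega), raise_of_ne (show i + 3 ≠ i + 1 by omega),
          raise_of_ne (show i + 3 ≠ i + 1 + 1 by omega)]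
        exact (lift_braid ..).2.1
      · rw [raise_of_ne h, raise_of_ne h', raise_of_ne h, raise_of_ne h', raise_of_ne h,
          raise_of_ne h']

theorem sweep_raise_of_lt {k y : ℕ} (h : k < y) (φ : ℕ → ℕ → ℝ) : sweep raise k φ y = φ y := by
  induction k generalizing φ with
  | zero => rfl
  | succ k ih =>
    change sweep raise k (raise k φ) y = _
    rw [ih (by omega), raise_of_ne (by omega)]

theorem sweep_raise_zero (k : ℕ) (φ : ℕ → ℕ → ℝ) : sweep raise k φ 0 = φ 0 := by
  induction k generalizing φ with
  | zero => rfl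
  | succ k ih =>
    change sweep raise k (raise k φ) 0 = _
    rw [ih, raise_of_ne (by omega)]

/-- The rightmost factor acts first, so levels are raised from the top down: each sees the new level
above and the old level below. -/
theorem sweep_raise_succ {k y : ℕ} (h : y < k) (φ : ℕ → ℕ → ℝ) :
    sweep raise k φ (y + 1) = lift (φ y) (φ (y + 1)) (sweep raise k φ (y + 2)) := by
  induction k generalizing φ with
  | zero => omega
  | succ k ih =>
    change sweep raise k (raise k φ) (y + 1) = lift _ _ (sweep raise k (raise k φ) (y + 2))
    rcases Nat.lt_or_ge y k with h1 | h1
    · rw [ih h1, raise_of_ne (by omega), raise_of_ne (by omega)]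
    · obtain rfl : y = k := by omega
      rw [sweep_raise_of_lt (by omega), raise_self, sweep_raise_of_lt (by omega),
        raise_of_ne (by omega)]

theorem stair_raise_of_le {m y : ℕ} (h : m ≤ y) (φ : ℕ → ℕ → ℝ) : stair raise m φ y = φ y := by
  induction m with
  | zero => rfl
  | succ m ih =>
    change sweep raise m (stair raise m φ) y = _
    rw [sweep_raise_of_lt h, ih (by omega)]

/-! ### The octahedron function of an array -/

/-- The octahedron function of an array: the value at `(x, y, z)` is the mass of the lowest `y` rows
after downward condensation of the first `x` columns and `z` rows. -/
noncomputable def oct (a : ℕ → ℕ → ℝ) (x y z : ℕ) : ℝ := stair raise z (fun j i => dint a i j) y x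

theorem dint_zero_left (a : ℕ → ℕ → ℝ) (j : ℕ) : dint a 0 j = 0 := by simp [dint]

theorem dint_zero_right (a : ℕ → ℕ → ℝ) (i : ℕ) : dint a i 0 = 0 := by simp [dint]

theorem dint_succ_left (a : ℕ → ℕ → ℝ) (i j : ℕ) :
    dint a (i + 1) j = dint a i j + tint (a (i + 1)) j := by
  simp [dint, tint, Finset.sum_Icc_succ_top]

theorem dint_succ_right (a : ℕ → ℕ → ℝ) (i j : ℕ) :
    dint a i (j + 1) = dint a i j + tint (fun k => a k (j + 1)) i := by
  simp [dint, tint, Finset.sum_Icc_succ_top, Finset.sum_add_distrib]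

theorem dint_transp (a : ℕ → ℕ → ℝ) (i j : ℕ) : dint (transp a) i j = dint a j i :=
  Finset.sum_comm

theorem oct_of_le (a : ℕ → ℕ → ℝ) {x y z : ℕ} (h : z ≤ y) : oct a x y z = dint a x y := by
  rw [oct, stair_raise_of_le h]

theorem oct_wall (a : ℕ → ℕ → ℝ) (x z : ℕ) : oct a x 0 z = 0 := by
  induction z with
  | zero => rw [oct_of_le _ le_rfl, dint_zero_right]
  | succ z ih =>
    change sweep raise z (stair raise z _) 0 x = 0
    rw [sweep_raise_zero]; exact ih

theorem oct_succ_eq_lift (a : ℕ → ℕ → ℝ) {y z : ℕ} (h : y + 1 ≤ z) :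
    (fun x => oct a x (y + 1) (z + 1)) =
      lift (fun x => oct a x y z) (fun x => oct a x (y + 1) z)
        (fun x => oct a x (y + 2) (z + 1)) :=
  sweep_raise_succ h _

theorem oct_rec (a : ℕ → ℕ → ℝ) (x : ℕ) {y z : ℕ} (h : y + 1 ≤ z) :
    oct a (x + 1) (y + 1) (z + 1) =
      max (oct a x y z + oct a (x + 1) (y + 2) (z + 1))
        (oct a (x + 1) (y + 1) z + oct a x (y + 1) (z + 1)) - oct a x (y + 1) z := by
  have := congrFun (oct_succ_eq_lift a h) (x + 1)
  rw [lift, ← congrFun (oct_succ_eq_lift a h) x] at this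
  rw [this, max_comm]
  congr 2 <;> ring

theorem oct_zero_left (a : ℕ → ℕ → ℝ) (y z : ℕ) : oct a 0 y z = 0 := by
  induction z generalizing y with
  | zero => rw [oct_of_le _ (Nat.zero_le _), dint_zero_left]
  | succ z ih =>
    rcases Nat.lt_or_ge y (z + 1) with h | h
    · cases y with
      | zero => exact oct_wall ..
      | succ y =>
        have := congrFun (oct_succ_eq_lift a (show y + 1 ≤ z by omega)) 0
        rw [lift] at this
        rw [this, ih]
    · rw [oct_of_le _ h, dint_zero_left]

/-- The octahedron function is tight in the second coordinate. -/
theorem oct_tight (a : ℕ → ℕ → ℝ) (x : ℕ) {y z : ℕ} (h : y + 1 < z) :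
    oct a (x + 1) (y + 2) z + oct a x y z ≤ oct a (x + 1) (y + 1) z + oct a x (y + 1) z := by
  have key := congrFun (isHecke_raise.mul_stair h) (fun j i => dint a i j)
  -- The condensed tower is fixed by `raise y`, so its level `y + 1` is itself a `lift` and inherits
  -- `add_le_lift_add`.
  change raise y (stair raise z _) = stair raise z _ at key
  have h1 := raise_self y (stair raise z (fun j i => dint a i j))
  rw [key] at h1
  have h2 := add_le_lift_add (stair raise z (fun j i => dint a i j) y)
    (stair raise z (fun j i => dint a i j) (y + 1))
    (stair raise z (fun j i => dint a i j) (y + 2)) x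
  rw [← h1] at h2
  exact h2

/-- Two functions with the octahedron recurrence and the same boundary values agree. -/
theorem rec_unique {F G : ℕ → ℕ → ℕ → ℝ} {N M : ℕ}
    (hF : ∀ x y z, x < N → z < M → y < x → y < z → F (x + 1) (y + 1) (z + 1) =
      max (F x y z + F (x + 1) (y + 2) (z + 1)) (F (x + 1) (y + 1) z + F x (y + 1) (z + 1))
        - F x (y + 1) z)
    (hG : ∀ x y z, x < N → z < M → y < x → y < z → G (x + 1) (y + 1) (z + 1) =
      max (G x y z + G (x + 1) (y + 2) (z + 1)) (G (x + 1) (y + 1) z + G x (y + 1) (z + 1))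
        - G x (y + 1) z)
    (h0 : ∀ x z, x ≤ N → z ≤ M → F x 0 z = G x 0 z)
    (hx : ∀ x z, x ≤ z → x ≤ N → z ≤ M → F x x z = G x x z)
    (hz : ∀ x z, z ≤ x → x ≤ N → z ≤ M → F x z z = G x z z)
    {x y z : ℕ} (hyx : y ≤ x) (hyz : y ≤ z) (hxN : x ≤ N) (hzM : z ≤ M) :
    F x y z = G x y z := by
  induction x generalizing y z with
  | zero =>
    obtain rfl : y = 0 := by omega
    exact h0 _ _ hxN hzM
  | succ x ihx =>
    induction z generalizing y with
    | zero =>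
      obtain rfl : y = 0 := by omega
      exact h0 _ _ hxN hzM
    | succ z ihz =>
      -- The rule at height `y + 1` uses height `y + 2` on the same vertical line, so `y` descends
      -- from its largest value.
      have hy : y ≤ min (x + 1) (z + 1) := by omega
      induction hy using Nat.decreasingInduction with
      | self =>
        rcases le_total (x + 1) (z + 1) with h | h
        · rw [min_eq_left h]; exact hx _ _ h hxN hzM
        · rw [min_eq_right h]; exact hz _ _ h hxN hzM
      | of_succ y hy ih =>
        cases y with
        | zero => exact h0 _ _ hxN hzM
        | succ y =>
          rw [hF x y z (by omega) (by omega) (by omega) (by omega),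
            hG x y z (by omega) (by omega) (by omega) (by omega),
            ih (by omega) (by omega), ihx (by omega) (by omega) (by omega) (by omega),
            ihx (by omega) (by omega) (by omega) (by omega),
            ihx (by omega) (by omega) (by omega) (by omega),
            ihz (by omega) (by omega) (by omega)]

/-- For a non-negative array the first `x` columns carry the mass of at most `x` rows. -/
theorem oct_of_nonneg {a : ℕ → ℕ → ℝ} {n m : ℕ}
    (ha : ∀ i j, 1 ≤ i → i ≤ n → 1 ≤ j → j ≤ m → 0 ≤ a i j) {x y z : ℕ} (hxy : x ≤ y)
    (hyz : y ≤ z) (hxn : x ≤ n) (hzm : z ≤ m) : oct a x y z = dint a x z := by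
  induction x generalizing y z with
  | zero => rw [oct_zero_left, dint_zero_left]
  | succ x ihx =>
    induction z generalizing y with
    | zero => omega
    | succ z ihz =>
      induction hyz using Nat.decreasingInduction with
      | self => exact oct_of_le _ le_rfl
      | of_succ y hy ih =>
        obtain ⟨y, rfl⟩ : ∃ k, y = k + 1 := ⟨y - 1, by omega⟩
        rw [oct_rec a x (by omega), ih (by omega),
          ihx (show x ≤ y by omega) (by omega) (by omega) (by omega),
          ihx (show x ≤ y + 1 by omega) (show y + 1 ≤ z by omega) (by omega) (by omega),
          ihx (show x ≤ y + 1 by omega) (show y + 1 ≤ z + 1 by omega) (by omega) (by omega),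
          ihz (by omega) (by omega) (by omega), max_eq_left]
        · ring
        -- The two candidates of the maximum differ by exactly the entry `a (x + 1) (z + 1)`.
        · have h1 := dint_succ_left a x z
          have h2 := dint_succ_left a x (z + 1)
          have h3 : tint (a (x + 1)) (z + 1) = tint (a (x + 1)) z + a (x + 1) (z + 1) := by
            simp [tint, Finset.sum_Icc_succ_top]
          linarith [ha (x + 1) (z + 1) (by omega) hxn (by omega) hzm]

/-- Exchanging `x` and `z` preserves the recurrence and swaps the faces `y = z` and `y = x`; on the
latter, non-negativity makes `oct` equal to `dint` as well. -/
theorem oct_transp {a : ℕ → ℕ → ℝ} {n m : ℕ}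
    (ha : ∀ i j, 1 ≤ i → i ≤ n → 1 ≤ j → j ≤ m → 0 ≤ a i j) {x y z : ℕ} (hyx : y ≤ x)
    (hyz : y ≤ z) (hxn : x ≤ n) (hzm : z ≤ m) : oct (transp a) z y x = oct a x y z := by
  refine rec_unique (F := fun x y z => oct (transp a) z y x) (G := oct a) (N := n) (M := m)
    (fun x y z _ _ h _ => ?_) (fun x y z _ _ _ h => oct_rec a x h) (fun x z _ _ => ?_)
    (fun x z h hx hz => ?_) (fun x z h hx hz => ?_) hyx hyz hxn hzm
  · rw [oct_rec _ z h, add_comm (oct (transp a) (z + 1) (y + 1) x)]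
  · rw [oct_wall, oct_wall]
  · rw [oct_of_le _ le_rfl, dint_transp, oct_of_nonneg ha le_rfl h hx hz]
  · rw [oct_of_le _ le_rfl, ← dint_transp]
    exact oct_of_nonneg (fun i j h1 h2 h3 h4 => ha j i h3 h4 h1 h2) le_rfl h hz hx

/-! ### Slope bounds and right-tight arrays -/

/-- An upper bound for the slopes between successive levels survives the raising of a level. -/
theorem raise_slope_le {φ : ℕ → ℕ → ℝ} {e : ℝ} {x N i : ℕ} (hi : i + 2 ≤ N)
    (h : ∀ y, y < N → φ (y + 1) (x + 2) - φ (y + 1) (x + 1) ≤ e + φ y (x + 1) - φ y x) :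
    ∀ y, y < N → raise i φ (y + 1) (x + 2) - raise i φ (y + 1) (x + 1)
      ≤ e + raise i φ y (x + 1) - raise i φ y x := by
  intro y hy
  by_cases h1 : y = i
  · subst h1
    rw [raise_self, raise_of_ne (by omega)]
    have h0 := h y hy
    have h2 := h (y + 1) (by omega)
    have h3 := add_le_lift_add (φ y) (φ (y + 1)) (φ (y + 2)) x
    rw [lift]
    rcases max_choice (lift (φ y) (φ (y + 1)) (φ (y + 2)) (x + 1) + φ (y + 1) (x + 1 + 1))
      (φ (y + 2) (x + 1 + 1) + φ y (x + 1)) with h4 | h4 <;> rw [h4]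
    · linarith
    · have h5 : φ (y + 1 + 1) = φ (y + 2) := rfl
      rw [h5] at h2
      linarith
  · rw [raise_of_ne (show y + 1 ≠ i + 1 by omega)]
    by_cases h2 : y = i + 1
    · subst h2
      rw [raise_self]
      -- Here the raised level is on the right-hand side, and raising only increases its increments.
      have h3 := sub_le_lift_sub (φ i) (φ (i + 1)) (φ (i + 2)) x
      linarith [h (i + 1) hy]
    · rw [raise_of_ne h2]; exact h y hy

theorem stair_slope_le {φ : ℕ → ℕ → ℝ} {e : ℝ} {x N m : ℕ} (hm : m ≤ N)
    (h : ∀ y, y < N → φ (y + 1) (x + 2) - φ (y + 1) (x + 1) ≤ e + φ y (x + 1) - φ y x) :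
    ∀ y, y < N → stair raise m φ (y + 1) (x + 2) - stair raise m φ (y + 1) (x + 1)
      ≤ e + stair raise m φ y (x + 1) - stair raise m φ y x := by
  have hsw : ∀ k, k + 1 ≤ N → ∀ φ : ℕ → ℕ → ℝ,
      (∀ y, y < N → φ (y + 1) (x + 2) - φ (y + 1) (x + 1) ≤ e + φ y (x + 1) - φ y x) →
      ∀ y, y < N → sweep raise k φ (y + 1) (x + 2) - sweep raise k φ (y + 1) (x + 1)
        ≤ e + sweep raise k φ y (x + 1) - sweep raise k φ y x := by
    intro k
    induction k with
    | zero => exact fun _ φ h => h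
    | succ k ih => exact fun hk φ h => ih (by omega) _ (raise_slope_le (by omega) h)
  induction m with
  | zero => exact h
  | succ m ih => exact hsw m hm _ (ih (by omega))

theorem oct_slope_le {a : ℕ → ℕ → ℝ} {e : ℝ} {x m : ℕ}
    (h : ∀ y, y < m → dint a (x + 2) (y + 1) - dint a (x + 1) (y + 1)
      ≤ e + dint a (x + 1) y - dint a x y) {y : ℕ} (hy : y < m) :
    oct a (x + 2) (y + 1) m - oct a (x + 1) (y + 1) m ≤ e + oct a (x + 1) y m - oct a x y m :=
  stair_slope_le le_rfl h y hy

/-- The octahedron function of a non-negative array which is tight to the right. -/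
theorem oct_of_tight_right {a : ℕ → ℕ → ℝ} {c : ℕ → ℝ} {m : ℕ}
    (ha : ∀ i j, 1 ≤ i → i ≤ m → 1 ≤ j → j ≤ m → 0 ≤ a i j)
    (hc : ∀ x, x < m → dint a (x + 1) m = dint a x m + c (x + 1))
    (ht : ∀ x y, x + 2 ≤ m → y < m → dint a (x + 2) (y + 1) - dint a (x + 1) (y + 1)
      ≤ c (x + 2) - c (x + 1) + dint a (x + 1) y - dint a x y) {x y : ℕ} (hyx : y ≤ x)
    (hxm : x < m) : oct a (x + 1) (y + 1) m = oct a x y m + c (x + 1) := by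
  have diag : ∀ x, x < m → oct a (x + 1) (x + 1) m = oct a x x m + c (x + 1) := fun x hx => by
    rw [oct_of_nonneg ha le_rfl hx (by omega) le_rfl,
      oct_of_nonneg ha le_rfl hx.le (by omega) le_rfl, hc x hx]
  -- Both bounds start at `x = y`, where `oct` is a full column mass: the slope bound propagates `≤`
  -- as `x` grows, downward tightness propagates `≥` as `y` falls.
  refine le_antisymm ?_ ?_
  · induction x, hyx using Nat.le_induction with
    | base => exact (diag y hxm).le
    | succ x hx ih =>
      have := ih (by omega)
      have := oct_slope_le (x := x) (fun y => ht x y (by omega)) (show y < m by omega)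
      linarith
  · induction hyx using Nat.decreasingInduction with
    | self => exact (diag x hxm).ge
    | of_succ y hy ih => linarith [oct_tight a x (show y + 1 < m by omega)]

/-! ### The condensations in terms of the octahedron function -/

theorem beta_zero (j : ℕ) (a : ℕ → ℕ → ℝ) : beta j a 0 = 0 := by simp [beta]

theorem beta_succ (j : ℕ) (a : ℕ → ℕ → ℝ) (i : ℕ) :
    beta (j + 1) a (i + 1) =
      dint a (i + 1) (j + 2) - dint a (i + 1) (j + 1) - (dint a i (j + 1) - dint a i j) := by
  rw [show j + 2 = (j + 1) + 1 from rfl, dint_succ_right a _ (j + 1), dint_succ_right a i j]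
  simp only [beta, tint]
  rw [show Finset.Ico 1 (i + 1) = Finset.Icc 1 i by ext; simp]
  ring

theorem beta_le_prefMax (j : ℕ) (a : ℕ → ℕ → ℝ) {i x : ℕ} (h : i ≤ x) :
    beta j a i ≤ prefMax j a x :=
  Finset.le_sup' (beta j a) (Finset.mem_range_succ_iff.2 h)

theorem prefMax_le {j : ℕ} {a : ℕ → ℕ → ℝ} {x : ℕ} {c : ℝ} (h : ∀ i ≤ x, beta j a i ≤ c) :
    prefMax j a x ≤ c :=
  Finset.sup'_le _ _ fun i hi => h i (Finset.mem_range_succ_iff.1 hi)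

theorem exists_beta_eq_prefMax (j : ℕ) (a : ℕ → ℕ → ℝ) (x : ℕ) :
    ∃ i ≤ x, beta j a i = prefMax j a x := by
  obtain ⟨i, hi, h⟩ := Finset.exists_mem_eq_sup' (Finset.nonempty_range_add_one (n := x)) (beta j a)
  exact ⟨i, Finset.mem_range_succ_iff.1 hi, h.symm⟩

theorem prefMax_zero (j : ℕ) (a : ℕ → ℕ → ℝ) : prefMax j a 0 = 0 := by
  obtain ⟨i, hi, h⟩ := exists_beta_eq_prefMax j a 0
  obtain rfl : i = 0 := by omega
  rw [← h, beta_zero]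

theorem prefMax_mono (j : ℕ) (a : ℕ → ℕ → ℝ) {x y : ℕ} (h : x ≤ y) :
    prefMax j a x ≤ prefMax j a y :=
  prefMax_le fun _ hi => beta_le_prefMax j a (hi.trans h)

theorem prefMax_succ (j : ℕ) (a : ℕ → ℕ → ℝ) (x : ℕ) :
    prefMax j a (x + 1) = max (prefMax j a x) (beta j a (x + 1)) := by
  refine le_antisymm (prefMax_le fun i hi => ?_)
    (max_le (prefMax_mono _ _ (by omega)) (beta_le_prefMax _ _ le_rfl))
  rcases Nat.lt_or_ge i (x + 1) with h | h
  · exact le_max_of_le_left (beta_le_prefMax _ _ (by omega))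
  · obtain rfl : i = x + 1 := by omega
    exact le_max_right _ _

theorem lift_dint (a : ℕ → ℕ → ℝ) (j x : ℕ) :
    lift (fun i => dint a i j) (fun i => dint a i (j + 1)) (fun i => dint a i (j + 2)) x =
      dint a x (j + 1) + prefMax (j + 1) a x := by
  induction x with
  | zero => rw [lift, prefMax_zero, add_zero]
  | succ x ih =>
    rw [lift, ih, prefMax_succ, beta_succ]
    rcases max_cases (prefMax (j + 1) a x) (dint a (x + 1) (j + 2) - dint a (x + 1) (j + 1)
      - (dint a x (j + 1) - dint a x j)) with ⟨h, h'⟩ | ⟨h, h'⟩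
    · rw [h, max_eq_left (by linarith)]; ring
    · rw [h, max_eq_right (by linarith)]; ring

/-! ### Single steps of `D_j` and their termination -/

theorem argMax_mem (n j : ℕ) (a : ℕ → ℕ → ℝ) :
    argMax n j a ≤ n ∧ beta j a (argMax n j a) = prefMax j a n :=
  Nat.sInf_mem (s := {i | i ≤ n ∧ beta j a i = prefMax j a n}) (exists_beta_eq_prefMax j a n)

theorem argMax_le {n j : ℕ} {a : ℕ → ℕ → ℝ} {i : ℕ} (hi : i ≤ n)
    (h : beta j a i = prefMax j a n) : argMax n j a ≤ i :=
  Nat.sInf_le ⟨hi, h⟩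

theorem prefMax_lt_of_lt_argMax {n j : ℕ} {a : ℕ → ℕ → ℝ} {i : ℕ} (h : i < argMax n j a) :
    prefMax j a i < prefMax j a n := by
  have hn := (argMax_mem n j a).1
  refine lt_of_le_of_ne (prefMax_mono _ _ (by omega)) fun heq => ?_
  obtain ⟨k, hk, hk'⟩ := exists_beta_eq_prefMax j a i
  have := argMax_le (show k ≤ n by omega) (hk'.trans heq)
  omega

/-- The mass moved by the operation `D_j`. -/
noncomputable def move (n j : ℕ) (a : ℕ → ℕ → ℝ) : ℝ :=
  min 1 (prefMax j a n - prefMax j a (argMax n j a - 1))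

theorem move_pos {n j : ℕ} {a : ℕ → ℕ → ℝ} (h : argMax n j a ≠ 0) : 0 < move n j a :=
  lt_min one_pos (sub_pos.2 (prefMax_lt_of_lt_argMax (by omega)))

theorem opD_of_argMax_eq_zero {n j : ℕ} {a : ℕ → ℕ → ℝ} (h : argMax n j a = 0) :
    opD n j a = a := by simp [opD, h]

theorem opD_eq {n j : ℕ} {a : ℕ → ℕ → ℝ} (h : argMax n j a ≠ 0) :
    opD n j a = fun i l => a i l + if i = argMax n j a then
      (if l = j then move n j a else 0) - (if l = j + 1 then move n j a else 0) else 0 := by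
  funext i l
  simp only [opD, h, if_false, move]
  by_cases h1 : i = argMax n j a <;> by_cases h2 : l = j <;> by_cases h3 : l = j + 1 <;>
    simp [h1, h2, h3]
  ring

theorem opD_ne {n j : ℕ} {a : ℕ → ℕ → ℝ} (h : argMax n j a ≠ 0) : opD n j a ≠ a := fun heq => by
  have := congrFun (congrFun heq (argMax n j a)) j
  rw [opD_eq h] at this
  have hp := move_pos h
  simp at this
  linarith

theorem dint_opD {n j : ℕ} {a : ℕ → ℕ → ℝ} (h : argMax n (j + 1) a ≠ 0) (x y : ℕ) :
    dint (opD n (j + 1) a) x y = dint a x y +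
      if argMax n (j + 1) a ≤ x ∧ y = j + 1 then move n (j + 1) a else 0 := by
  rw [opD_eq h]
  simp only [dint, Finset.sum_add_distrib]
  congr 1
  have hin : ∀ k, (∑ l ∈ Finset.Icc 1 y, if k = argMax n (j + 1) a then
      (if l = j + 1 then move n (j + 1) a else 0)
        - (if l = j + 1 + 1 then move n (j + 1) a else 0) else 0) =
      if k = argMax n (j + 1) a then (if y = j + 1 then move n (j + 1) a else 0) else 0 := by
    intro k
    split_ifs with h1 h2
    · rw [Finset.sum_sub_distrib, Finset.sum_ite_eq', Finset.sum_ite_eq',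
        if_pos (Finset.mem_Icc.2 (by omega)), if_neg (by rw [Finset.mem_Icc]; omega), sub_zero]
    · rw [Finset.sum_sub_distrib, Finset.sum_ite_eq', Finset.sum_ite_eq']
      rcases Nat.lt_or_ge y (j + 1) with h3 | h3
      · rw [if_neg (by rw [Finset.mem_Icc]; omega), if_neg (by rw [Finset.mem_Icc]; omega),
          sub_zero]
      · rw [if_pos (Finset.mem_Icc.2 (by omega)), if_pos (Finset.mem_Icc.2 (by omega)), sub_self]
    · simp
  simp only [hin]
  rw [Finset.sum_ite_eq']
  by_cases h1 : argMax n (j + 1) a ≤ x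
  · rw [if_pos (Finset.mem_Icc.2 (by omega))]; simp [h1]
  · rw [if_neg (by rw [Finset.mem_Icc]; omega)]; simp [h1]

theorem beta_opD {n j : ℕ} {a : ℕ → ℕ → ℝ} (h : argMax n (j + 1) a ≠ 0) (i : ℕ) :
    beta (j + 1) (opD n (j + 1) a) i = beta (j + 1) a i -
      ((if argMax n (j + 1) a ≤ i then move n (j + 1) a else 0) +
        if argMax n (j + 1) a < i then move n (j + 1) a else 0) := by
  cases i with
  | zero => simp [beta_zero, h]
  | succ i =>
    rw [beta_succ, beta_succ]
    simp only [dint_opD h, Nat.lt_succ_iff]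
    simp
    ring

theorem prefMax_opD_of_lt {n j : ℕ} {a : ℕ → ℕ → ℝ} {x : ℕ} (hx : x < argMax n (j + 1) a) :
    prefMax (j + 1) (opD n (j + 1) a) x = prefMax (j + 1) a x := by
  have hb : ∀ i ≤ x, beta (j + 1) (opD n (j + 1) a) i = beta (j + 1) a i := fun i hi => by
    rw [beta_opD (by omega), if_neg (by omega), if_neg (by omega)]; ring
  exact le_antisymm (prefMax_le fun i hi => by rw [hb i hi]; exact beta_le_prefMax _ _ hi)
    (prefMax_le fun i hi => by rw [← hb i hi]; exact beta_le_prefMax _ _ hi)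

theorem prefMax_opD_of_le {n j : ℕ} {a : ℕ → ℕ → ℝ} (h : argMax n (j + 1) a ≠ 0) {x : ℕ}
    (hx : argMax n (j + 1) a ≤ x) (hxn : x ≤ n) :
    prefMax (j + 1) (opD n (j + 1) a) x = prefMax (j + 1) a n - move n (j + 1) a := by
  have hs := (argMax_mem n (j + 1) a).2
  have hp := move_pos h
  have hm : move n (j + 1) a ≤ prefMax (j + 1) a n - prefMax (j + 1) a (argMax n (j + 1) a - 1) :=
    min_le_right _ _
  refine le_antisymm (prefMax_le fun i hi => ?_) ?_
  · rw [beta_opD h]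
    rcases Nat.lt_or_ge i (argMax n (j + 1) a) with h1 | h1
    · rw [if_neg (by omega), if_neg (by omega)]
      linarith [beta_le_prefMax (j + 1) a (show i ≤ argMax n (j + 1) a - 1 by omega)]
    · rw [if_pos h1]
      have := beta_le_prefMax (j + 1) a (show i ≤ n by omega)
      split_ifs <;> linarith
  · have := beta_le_prefMax (j + 1) (opD n (j + 1) a) hx
    rw [beta_opD h, if_pos le_rfl, if_neg (lt_irrefl _), hs] at this
    linarith

/-- The tower of level functions of an array. -/
noncomputable def tower (a : ℕ → ℕ → ℝ) : ℕ → ℕ → ℝ := fun j i => dint a i j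

theorem raise_tower (a : ℕ → ℕ → ℝ) (j x : ℕ) :
    raise j (tower a) (j + 1) x = dint a x (j + 1) + prefMax (j + 1) a x := by
  rw [raise_self]; exact lift_dint a j x

/-- From the chosen column on, a step adds the moved mass to level `j + 1` and subtracts it from the
prefix maximum, so the sum in `raise_tower` is invariant. -/
theorem raise_tower_opD (n j : ℕ) (a : ℕ → ℕ → ℝ) {x : ℕ} (hx : x ≤ n) (y : ℕ) :
    raise j (tower (opD n (j + 1) a)) y x = raise j (tower a) y x := by
  by_cases h : argMax n (j + 1) a = 0
  · rw [opD_of_argMax_eq_zero h]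
  by_cases hy : y = j + 1
  · subst hy
    rw [raise_tower, raise_tower, dint_opD h]
    rcases Nat.lt_or_ge x (argMax n (j + 1) a) with h1 | h1
    · rw [prefMax_opD_of_lt h1, if_neg (by omega)]; ring
    · rw [prefMax_opD_of_le h h1 hx, if_pos ⟨h1, rfl⟩, le_antisymm
        (prefMax_mono (j + 1) a hx) ((argMax_mem n (j + 1) a).2 ▸ beta_le_prefMax _ _ h1)]
      ring
  · rw [raise_of_ne hy, raise_of_ne hy]
    simp only [tower]
    rw [dint_opD h, if_neg (by omega), add_zero]

/-- Double induction on a bound `s` for the first maximum and a bound `k` for the gap to the maximum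
before `s`. A step moves mass `1` and shrinks the gap by `1`, or closes it, and the maximum is then
reached earlier. -/
theorem exists_iterate_opD (n j : ℕ) (a : ℕ → ℕ → ℝ) :
    ∃ e, argMax n (j + 1) ((opD n (j + 1))^[e] a) = 0 := by
  have key : ∀ s k : ℕ, ∀ a : ℕ → ℕ → ℝ, argMax n (j + 1) a ≤ s →
      prefMax (j + 1) a n - prefMax (j + 1) a (s - 1) ≤ k →
      ∃ e, argMax n (j + 1) ((opD n (j + 1))^[e] a) = 0 := by
    intro s
    induction s with
    | zero => exact fun k a h _ => ⟨0, by simpa using h⟩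
    | succ s ihs =>
      have lower : ∀ a : ℕ → ℕ → ℝ, argMax n (j + 1) a ≤ s →
          ∃ e, argMax n (j + 1) ((opD n (j + 1))^[e] a) = 0 := fun a h =>
        ihs _ a h (Nat.le_ceil _)
      intro k
      induction k with
      | zero =>
        intro a h hk
        refine lower a ?_
        by_contra hlt
        have := prefMax_lt_of_lt_argMax (show s + 1 - 1 < argMax n (j + 1) a by omega)
        rw [Nat.add_sub_cancel] at this hk
        push_cast at hk
        linarith
      | succ k ihk =>
        intro a h hk
        rcases Nat.lt_or_ge s (argMax n (j + 1) a) with h1 | h1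
        swap
        · exact lower a h1
        have hs : argMax n (j + 1) a = s + 1 := by omega
        have hn := (argMax_mem n (j + 1) a).1
        have hle := prefMax_opD_of_le (by omega) hn le_rfl
        have hlt := prefMax_opD_of_lt (show s < argMax n (j + 1) a by omega)
        have hsuff : ∃ e, argMax n (j + 1) ((opD n (j + 1))^[e] (opD n (j + 1) a)) = 0 := by
          have hm : move n (j + 1) a = min 1 (prefMax (j + 1) a n - prefMax (j + 1) a s) := by
            rw [move, hs, Nat.add_sub_cancel]
          rcases min_choice 1 (prefMax (j + 1) a n - prefMax (j + 1) a s)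
            with h2 | h2 <;> rw [← hm] at h2
          · refine ihk _ ?_ ?_
            · rw [← hs]
              refine argMax_le hn ?_
              rw [hle, beta_opD (by omega), if_pos le_rfl, if_neg (lt_irrefl _),
                (argMax_mem n (j + 1) a).2]
              ring
            · rw [Nat.add_sub_cancel, hle, hlt, h2]
              rw [Nat.add_sub_cancel] at hk
              push_cast at hk
              linarith
          · refine lower _ ?_
            obtain ⟨i, hi, hi'⟩ := exists_beta_eq_prefMax (j + 1) (opD n (j + 1) a) s
            refine (argMax_le (show i ≤ n by omega) ?_).trans hi
            rw [hi', hlt, hle, h2]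
            ring
        obtain ⟨e, he⟩ := hsuff
        exact ⟨e + 1, he⟩
  exact key _ _ a le_rfl (Nat.le_ceil _)

theorem argMax_bigD (n j : ℕ) (a : ℕ → ℕ → ℝ) : argMax n (j + 1) (bigD n (j + 1) a) = 0 := by
  obtain ⟨e, he⟩ := exists_iterate_opD n j a
  -- Termination is needed because `sInf ∅ = 0` would not be a stabilization index.
  have hmem := Nat.sInf_mem (s := {e | (opD n (j + 1))^[e + 1] a = (opD n (j + 1))^[e] a})
    ⟨e, by change _ = _; rw [Function.iterate_succ_apply', opD_of_argMax_eq_zero he]⟩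
  by_contra h
  change _ = _ at hmem
  rw [Function.iterate_succ_apply'] at hmem
  exact opD_ne h hmem

theorem tower_bigD (n j : ℕ) (a : ℕ → ℕ → ℝ) {x : ℕ} (hx : x ≤ n) (y : ℕ) :
    tower (bigD n (j + 1) a) y x = raise j (tower a) y x := by
  have h1 : raise j (tower (bigD n (j + 1) a)) y x = raise j (tower a) y x := by
    rw [bigD]
    generalize sInf {e | (opD n (j + 1))^[e + 1] a = (opD n (j + 1))^[e] a} = e
    induction e generalizing a with
    | zero => rfl
    | succ e ih => rw [Function.iterate_succ_apply, ih, raise_tower_opD n j a hx]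
  rw [← h1]
  by_cases hy : y = j + 1
  · subst hy
    have h2 := (argMax_mem n (j + 1) (bigD n (j + 1) a)).2
    rw [argMax_bigD, beta_zero] at h2
    have h3 := prefMax_mono (j + 1) (bigD n (j + 1) a) hx
    have h4 := prefMax_mono (j + 1) (bigD n (j + 1) a) (Nat.zero_le x)
    rw [prefMax_zero] at h4
    rw [raise_tower, show prefMax (j + 1) (bigD n (j + 1) a) x = 0 by linarith, add_zero, tower]
  · rw [raise_of_ne hy]

/-! ### From `bigD` to the full condensations -/

theorem lift_congr {p q r p' q' r' : ℕ → ℝ} {n : ℕ} (hp : ∀ x ≤ n, p x = p' x)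
    (hq : ∀ x ≤ n, q x = q' x) (hr : ∀ x ≤ n, r x = r' x) :
    ∀ x ≤ n, lift p q r x = lift p' q' r' x := by
  intro x hx
  induction x with
  | zero => exact hq 0 hx
  | succ x ih =>
    rw [lift, lift, ih (by omega), hp x (by omega), hq x (by omega), hq _ hx, hr _ hx]

theorem raise_congr {φ ψ : ℕ → ℕ → ℝ} {n : ℕ} (h : ∀ y, ∀ x ≤ n, φ y x = ψ y x) (i : ℕ) :
    ∀ y, ∀ x ≤ n, raise i φ y x = raise i ψ y x := by
  intro y
  by_cases hy : y = i + 1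
  · subst hy
    rw [raise_self, raise_self]
    exact lift_congr (h _) (h _) (h _)
  · rw [raise_of_ne hy, raise_of_ne hy]; exact h y

theorem sweep_raise_congr {φ ψ : ℕ → ℕ → ℝ} {n : ℕ} (h : ∀ y, ∀ x ≤ n, φ y x = ψ y x) (k : ℕ) :
    ∀ y, ∀ x ≤ n, sweep raise k φ y x = sweep raise k ψ y x := by
  induction k generalizing φ ψ with
  | zero => exact h
  | succ k ih => exact ih (raise_congr h k)

theorem tower_prodD (n r : ℕ) (a : ℕ → ℕ → ℝ) :
    ∀ y, ∀ x ≤ n, tower (prodD n r a) y x = sweep raise r (tower a) y x := by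
  induction r generalizing a with
  | zero => exact fun _ _ _ => rfl
  | succ r ih =>
    intro y x hx
    rw [prodD, ih _ y x hx]
    exact sweep_raise_congr (fun y x hx => tower_bigD n r a hx y) r y x hx

theorem dint_condD (n m : ℕ) (a : ℕ → ℕ → ℝ) {x : ℕ} (hx : x ≤ n) (y : ℕ) :
    dint (condD n m a) x y = oct a x y m := by
  cases m with
  | zero => exact (oct_of_le _ (Nat.zero_le _)).symm
  | succ m =>
    have key : ∀ e, ∀ y, ∀ x ≤ n, tower ((prodD n m)^[e] a) y x =
        (sweep raise m ^ e) (tower a) y x := by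
      intro e
      induction e with
      | zero => exact fun _ _ _ => rfl
      | succ e ih =>
        intro y x hx
        rw [Function.iterate_succ_apply', tower_prodD n m _ y x hx, pow_succ']
        exact sweep_raise_congr ih m y x hx
    have := key (m + 1) y x hx
    rw [isHecke_raise.sweep_pow] at this
    exact this

theorem oct_congr {a b : ℕ → ℕ → ℝ} {n m : ℕ}
    (h : ∀ i j, 1 ≤ i → i ≤ n → 1 ≤ j → j ≤ m → a i j = b i j) {x y z : ℕ} (hx : x ≤ n)
    (hyz : y ≤ z) (hzm : z ≤ m) : oct a x y z = oct b x y z := by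
  have hd : ∀ i j, i ≤ n → j ≤ m → dint a i j = dint b i j := fun i j hi hj =>
    Finset.sum_congr rfl fun k hk => Finset.sum_congr rfl fun l hl => by
      rw [Finset.mem_Icc] at hk hl
      exact h k l hk.1 (by omega) hl.1 (by omega)
  induction x generalizing y z with
  | zero => rw [oct_zero_left, oct_zero_left]
  | succ x ihx =>
    induction z generalizing y with
    | zero => rw [oct_of_le _ (Nat.zero_le y), oct_of_le _ (Nat.zero_le y), hd _ _ hx (by omega)]
    | succ z ihz =>
      induction hyz using Nat.decreasingInduction with
      | self => rw [oct_of_le _ le_rfl, oct_of_le _ le_rfl, hd _ _ hx hzm]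
      | of_succ y hy ih =>
        cases y with
        | zero => rw [oct_wall, oct_wall]
        | succ y =>
          rw [oct_rec a x (by omega), oct_rec b x (by omega), ih,
            ihx (by omega) (show y ≤ z by omega) (by omega),
            ihx (by omega) (show y + 1 ≤ z by omega) (by omega),
            ihx (by omega) (show y + 1 ≤ z + 1 by omega) hzm,
            ihz (show y + 1 ≤ z by omega) (by omega)]

theorem dint_condL {n m : ℕ} {a : ℕ → ℕ → ℝ}
    (ha : ∀ i j, 1 ≤ i → i ≤ n → 1 ≤ j → j ≤ m → 0 ≤ a i j) {y z : ℕ} (hyz : y ≤ z)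
    (hyn : y ≤ n) (hzm : z ≤ m) : dint (condL n m a) y z = oct a n y z := by
  rw [condL, dint_transp, dint_condD m n _ hzm, oct_transp ha hyn hyz le_rfl hzm]

/-! ### The array of a discrete concave function -/

theorem starF_of_le {n : ℕ} (f : ℕ → ℕ → ℝ) {x z : ℕ} (h : z ≤ x) :
    starF n f x z = f (n - x) (n - z) := by
  rw [starF, ext, min_eq_left (by omega)]

theorem starF_of_ge {n : ℕ} (f : ℕ → ℕ → ℝ) {x z : ℕ} (h : x ≤ z) :
    starF n f x z = f (n - z) (n - z) := by
  rw [starF, ext, min_eq_right (by omega)]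

theorem star_mixed {n : ℕ} (f : ℕ → ℕ → ℝ) {i j : ℕ} (hi : i < n) (hj : j < n) :
    star n n (mixed f) (i + 1) (j + 1) = starF n f (i + 1) (j + 1) - starF n f i (j + 1)
      - (starF n f (i + 1) j - starF n f i j) := by
  simp only [star, mixed, starF]
  rw [show n + 1 - (i + 1) = n - i by omega, show n + 1 - (j + 1) = n - j by omega,
    show n - i - 1 = n - (i + 1) by omega, show n - j - 1 = n - (j + 1) by omega]
  ring

theorem tint_succ (p : ℕ → ℝ) (j : ℕ) : tint p (j + 1) = tint p j + p (j + 1) := by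
  simp [tint, Finset.sum_Icc_succ_top]

theorem tint_zero (p : ℕ → ℝ) : tint p 0 = 0 := by simp [tint]

theorem dint_star_mixed {n : ℕ} (f : ℕ → ℕ → ℝ) {x z : ℕ} (hx : x ≤ n) (hz : z ≤ n) :
    dint (star n n (mixed f)) x z =
      starF n f x z - starF n f x 0 - starF n f 0 z + starF n f 0 0 := by
  induction x with
  | zero => rw [dint_zero_left]; ring
  | succ x ih =>
    have h : ∀ z, z ≤ n → tint (star n n (mixed f) (x + 1)) z =
        starF n f (x + 1) z - starF n f x z - (starF n f (x + 1) 0 - starF n f x 0) := by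
      intro z hz
      induction z with
      | zero => rw [tint_zero]; ring
      | succ z ihz => rw [tint_succ, ihz (by omega), star_mixed f hx hz]; ring
    rw [dint_succ_left, ih (by omega), h z hz]
    ring

section DC

variable {n : ℕ} {lam mu nu : ℕ → ℝ} {f : ℕ → ℕ → ℝ}

/-- By `rhombus₃` these increments decrease along the hypotenuse, and the last one is `mu n`. -/
theorem IsDC.diag_mono (hf : IsDC n lam mu nu f) (hmu : IsPartition n mu) {i : ℕ} (hi : i < n) :
    f i (i + 1) ≤ f (i + 1) (i + 1) := by
  obtain ⟨m, rfl⟩ : ∃ m, n = m + 1 := ⟨n - 1, by omega⟩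
  have hi' : i ≤ m := by omega
  induction hi' using Nat.decreasingInduction with
  | self => linarith [hf.top m hi, hmu.2 (m + 1) (by omega) le_rfl]
  | of_succ i h ih => linarith [ih (by omega), hf.rhombus₃ i (i + 1) le_rfl (by omega)]

theorem IsDC.star_mixed_nonneg (hf : IsDC n lam mu nu f) (hmu : IsPartition n mu) :
    ∀ i j, 1 ≤ i → i ≤ n → 1 ≤ j → j ≤ n → 0 ≤ star n n (mixed f) i j := by
  intro i j hi hin hj hjn
  obtain ⟨i, rfl⟩ : ∃ k, i = k + 1 := ⟨i - 1, by omega⟩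
  obtain ⟨j, rfl⟩ : ∃ k, j = k + 1 := ⟨j - 1, by omega⟩
  rw [star_mixed f hin hjn]
  rcases lt_trichotomy i j with h | rfl | h
  · rw [starF_of_ge f (show i + 1 ≤ j + 1 by omega), starF_of_ge f (show i ≤ j + 1 by omega),
      starF_of_ge f (show i + 1 ≤ j by omega), starF_of_ge f (show i ≤ j by omega)]
    linarith
  · rw [starF_of_ge f (le_refl _), starF_of_ge f (show i ≤ i + 1 by omega),
      starF_of_le f (show i ≤ i + 1 by omega), starF_of_ge f (le_refl i)]
    have := hf.diag_mono hmu (show n - (i + 1) < n by omega)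
    rw [show n - (i + 1) + 1 = n - i by omega] at this
    linarith
  · rw [starF_of_le f (show j + 1 ≤ i + 1 by omega), starF_of_le f (show j + 1 ≤ i by omega),
      starF_of_le f (show j ≤ i + 1 by omega), starF_of_le f (show j ≤ i by omega)]
    have := hf.rhombus₁ (n - (i + 1)) (n - (j + 1)) (by omega) (by omega)
    rw [show n - (i + 1) + 1 = n - i by omega, show n - (j + 1) + 1 = n - j by omega] at this
    linarith

theorem IsDC.starF_slope_left (hf : IsDC n lam mu nu f) {x y : ℕ} (hx : x + 2 ≤ n) (hy : y < n) :
    starF n f (x + 2) (y + 1) - starF n f (x + 1) (y + 1) ≤ starF n f (x + 1) y - starF n f x y := by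
  rcases Nat.lt_or_ge x y with h | h
  · rw [starF_of_ge f (show x + 2 ≤ y + 1 by omega), starF_of_ge f (show x + 1 ≤ y + 1 by omega),
      starF_of_ge f (show x + 1 ≤ y by omega), starF_of_ge f (show x ≤ y by omega)]
    linarith
  · rw [starF_of_le f (show y + 1 ≤ x + 2 by omega), starF_of_le f (show y + 1 ≤ x + 1 by omega),
      starF_of_le f (show y ≤ x + 1 by omega), starF_of_le f (show y ≤ x by omega)]
    have := hf.rhombus₃ (n - (x + 2)) (n - (y + 1)) (by omega) (by omega)
    rw [show n - (x + 2) + 1 = n - (x + 1) by omega, show n - (x + 2) + 2 = n - x by omega,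
      show n - (y + 1) + 1 = n - y by omega] at this
    linarith

theorem IsDC.starF_slope_right (hf : IsDC n lam mu nu f) (hnu : IsPartition n nu) {y z : ℕ}
    (hy : y < n) (hz : z + 2 ≤ n) :
    starF n f (y + 1) (z + 2) - starF n f (y + 1) (z + 1) ≤
      starF n f y (z + 1) - starF n f y z := by
  rcases Nat.lt_or_ge z y with h | h
  · rw [starF_of_le f (show z + 2 ≤ y + 1 by omega), starF_of_le f (show z + 1 ≤ y + 1 by omega),
      starF_of_le f (show z + 1 ≤ y by omega), starF_of_le f (show z ≤ y by omega)]
    have := hf.rhombus₂ (n - (y + 1)) (n - (z + 2)) (by omega) (by omega)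
    rw [show n - (y + 1) + 1 = n - y by omega, show n - (z + 2) + 2 = n - z by omega,
      show n - (z + 2) + 1 = n - (z + 1) by omega] at this
    linarith
  · rw [starF_of_ge f (show y + 1 ≤ z + 2 by omega), starF_of_ge f (show y + 1 ≤ z + 1 by omega),
      starF_of_ge f (show y ≤ z + 1 by omega), starF_of_ge f (show y ≤ z by omega)]
    have h1 := hf.hyp (n - (z + 2)) (by omega)
    have h2 := hf.hyp (n - (z + 1)) (by omega)
    have h3 := hnu.1 (n - (z + 2) + 1) (by omega) (by omega)
    rw [show n - (z + 2) + 1 = n - (z + 1) by omega] at h1 h3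
    rw [show n - (z + 1) + 1 = n - z by omega] at h2 h3
    linarith

theorem IsDC.oct_shift (hf : IsDC n lam mu nu f) (hmu : IsPartition n mu) {m : ℕ} (hm : m ≤ n)
    {x y : ℕ} (hyx : y ≤ x) (hxm : x < m) :
    oct (star n n (mixed f)) (x + 1) (y + 1) m =
      oct (star n n (mixed f)) x y m + (starF n f x 0 - starF n f (x + 1) 0) := by
  refine oct_of_tight_right (c := fun k => starF n f (k - 1) 0 - starF n f k 0)
    (fun i j h1 h2 h3 h4 => hf.star_mixed_nonneg hmu i j h1 (h2.trans hm) h3 (h4.trans hm))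
    (fun x hx => ?_) (fun x y hx hy => ?_) hyx hxm
  -- For `x ≤ z` the function `*f` does not depend on `x`, so these column sums do not involve `m`.
  · rw [dint_star_mixed f (by omega) hm, dint_star_mixed f (by omega) hm,
      starF_of_ge f (show x + 1 ≤ m by omega), starF_of_ge f (show x ≤ m by omega),
      Nat.add_sub_cancel]
    ring
  · rw [dint_star_mixed f (by omega) (by omega), dint_star_mixed f (by omega) (by omega),
      dint_star_mixed f (by omega) (by omega), dint_star_mixed f (by omega) (by omega)]
    have := hf.starF_slope_left (show x + 2 ≤ n by omega) (show y < n by omega)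
    simp only [Nat.add_sub_cancel, show x + 2 - 1 = x + 1 by omega]
    linarith

theorem IsDC.oct_diag (hf : IsDC n lam mu nu f) (hmu : IsPartition n mu) {m y : ℕ} (hm : m ≤ n)
    (hy : y ≤ m) :
    oct (star n n (mixed f)) m y m = starF n f (m - y) 0 - starF n f m 0 := by
  have key : ∀ y k, k + y ≤ m →
      oct (star n n (mixed f)) (k + y) y m = starF n f k 0 - starF n f (k + y) 0 := by
    intro y
    induction y with
    | zero => intro k _; rw [oct_wall]; simp
    | succ y ih =>
      intro k hk
      rw [← add_assoc, hf.oct_shift hmu hm (by omega) (by omega), ih k (by omega)]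
      ring
  have := key y (m - y) (by omega)
  rwa [Nat.sub_add_cancel hy] at this

theorem IsDC.oct_slope (hf : IsDC n lam mu nu f) (hmu : IsPartition n mu)
    (hnu : IsPartition n nu) {y z : ℕ} (hyz : y ≤ z) (hz : z + 2 ≤ n) :
    oct (star n n (mixed f)) n (y + 1) (z + 2) - oct (star n n (mixed f)) n (y + 1) (z + 1) ≤
      2 * starF n f 0 (z + 1) - starF n f 0 (z + 2) - starF n f 0 z
        + oct (star n n (mixed f)) n y (z + 1) - oct (star n n (mixed f)) n y z := by
  -- The constant `e` is `ν_{n-z-1} - ν_{n-z}`; transposition turns the slope bound in `x` into one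
  -- in `z`.
  have h := oct_slope_le (a := transp (star n n (mixed f))) (x := z) (m := n)
    (e := 2 * starF n f 0 (z + 1) - starF n f 0 (z + 2) - starF n f 0 z) (fun y hy => by
      simp only [dint_transp]
      rw [dint_star_mixed f (by omega) (by omega), dint_star_mixed f (by omega) (by omega),
        dint_star_mixed f (by omega) (by omega), dint_star_mixed f (by omega) (by omega)]
      linarith [hf.starF_slope_right hnu hy hz]) (show y < n by omega)
  have hA := hf.star_mixed_nonneg hmu
  rwa [oct_transp hA (by omega) (by omega) le_rfl (by omega),
    oct_transp hA (by omega) (by omega) le_rfl (by omega),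
    oct_transp hA (by omega) (by omega) le_rfl (by omega),
    oct_transp hA (by omega) (by omega) le_rfl (by omega)] at h

/-! ### Propagation in the prism and in the quarter -/

/-- The propagation of `*f` in the prism. -/
noncomputable def prism (n : ℕ) (f : ℕ → ℕ → ℝ) (x y z : ℕ) : ℝ :=
  oct (star n n (mixed f)) x y z + starF n f x 0 + starF n f 0 z - starF n f 0 0

theorem isPrismOR_prism (n : ℕ) (f : ℕ → ℕ → ℝ) : IsPrismOR n (prism n f) where
  inner x y z hy _ _ := by
    simp only [prism]
    rw [oct_rec _ x hy]
    simp only [max_def]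
    split_ifs <;> linarith
  wall x z _ _ := by
    simp only [prism, oct_wall]
    ring

theorem prism_diag (n : ℕ) (f : ℕ → ℕ → ℝ) {i j : ℕ} (hi : i ≤ n) (hj : j ≤ n) :
    prism n f i j j = starF n f i j := by
  rw [prism, oct_of_le _ le_rfl, dint_star_mixed f hi hj]
  ring

theorem IsDC.prism_wall_zx (hf : IsDC n lam mu nu f) (hmu : IsPartition n mu) {x y : ℕ}
    (hx : x ≤ n) (hy : y ≤ x) :
    prism n f x y x = starF n f (x - y) 0 + starF n f 0 x - starF n f 0 0 := by
  rw [prism, hf.oct_diag hmu hx hy]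
  ring

theorem IsDC.isQuarterOR_prism (hf : IsDC n lam mu nu f) (hmu : IsPartition n mu) :
    IsQuarterOR n (prism n f) where
  inner x y z hy hz hx := (isPrismOR_prism n f).inner x y z hy (by omega) hx
  wall_y x z hz hx := (isPrismOR_prism n f).wall x z (by omega) hx
  wall_zx x y hy hx := by
    rw [hf.prism_wall_zx hmu (by omega) (by omega), hf.prism_wall_zx hmu (by omega) (by omega),
      hf.prism_wall_zx hmu (by omega) (by omega), hf.prism_wall_zx hmu (by omega) (by omega),
      show x + 1 - (y + 1) = x - y by omega, show x + 1 - (y + 2) = x - (y + 1) by omega]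
    ring
  edge x hx := by
    rw [hf.prism_wall_zx hmu (by omega) (by omega), hf.prism_wall_zx hmu (by omega) (by omega),
      hf.prism_wall_zx hmu (by omega) (by omega), prism, oct_wall, Nat.add_sub_cancel,
      Nat.sub_zero, Nat.sub_zero]
    ring

theorem IsQuarterOR.unique {F G : ℕ → ℕ → ℕ → ℝ} (hF : IsQuarterOR n F) (hG : IsQuarterOR n G)
    (h0 : ∀ i j, j ≤ i → i ≤ n → F i j j = G i j j) {x y z : ℕ} (hyz : y ≤ z) (hzx : z ≤ x)
    (hxn : x ≤ n) : F x y z = G x y z := by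
  induction x generalizing y z with
  | zero =>
    obtain rfl : z = 0 := by omega
    obtain rfl : y = 0 := by omega
    exact h0 _ _ hzx hxn
  | succ x ihx =>
    induction z generalizing y with
    | zero =>
      obtain rfl : y = 0 := by omega
      exact h0 _ _ hzx hxn
    | succ z ihz =>
      induction hyz using Nat.decreasingInduction with
      | self => exact h0 _ _ hzx hxn
      | of_succ y hy ih =>
        rcases Nat.lt_or_ge z x with hz | hz
        · cases y with
          | zero =>
            rw [hF.wall_y x z hz hxn, hG.wall_y x z hz hxn, ihz (by omega) (by omega),
              ihx (by omega) (show z + 1 ≤ x by omega) (by omega),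
              ihx (by omega) (show z ≤ x by omega) (by omega)]
          | succ y =>
            rw [hF.inner x y z (by omega) hz hxn, hG.inner x y z (by omega) hz hxn, ih,
              ihz (by omega) (by omega),
              ihx (show y ≤ z by omega) (by omega) (by omega),
              ihx (show y + 1 ≤ z + 1 by omega) (by omega) (by omega),
              ihx (show y + 1 ≤ z by omega) (by omega) (by omega)]
        · obtain rfl : z = x := by omega
          cases y with
          | zero =>
            rw [hF.edge z hxn, hG.edge z hxn, ih, ihz (by omega) (by omega),
              ihx (by omega) (by omega) (by omega)]
          | succ y =>
            rw [hF.wall_zx z y (by omega) hxn, hG.wall_zx z y (by omega) hxn, ih,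
              ihx (show y ≤ z by omega) (by omega) (by omega),
              ihx (show y + 1 ≤ z by omega) (by omega) (by omega)]

theorem IsDC.tint_rev (hf : IsDC n lam mu nu f) {j : ℕ} (hj : j ≤ n) :
    tint (rev n nu) j = starF n f 0 0 - starF n f 0 j := by
  induction j with
  | zero => rw [tint_zero, sub_self]
  | succ j ih =>
    have := hf.hyp (n - (j + 1)) (by omega)
    rw [show n - (j + 1) + 1 = n - j by omega] at this
    rw [tint_succ, ih (by omega), rev, show n + 1 - (j + 1) = n - j by omega,
      starF_of_ge f (Nat.zero_le j), starF_of_ge f (Nat.zero_le (j + 1)), ← this]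
    ring

theorem IsDC.tint_hyp (hf : IsDC n lam mu nu f) : tint nu n = starF n f 0 0 := by
  rw [starF_of_ge f le_rfl, Nat.sub_zero]
  have key : ∀ k ≤ n, tint nu k = f k k := by
    intro k hk
    induction k with
    | zero => rw [tint_zero, hf.zero]
    | succ k ih => rw [tint_succ, ih (by omega), ← hf.hyp k hk]; ring
  exact key n le_rfl

theorem IsDC.hF_eq (hf : IsDC n lam mu nu f) (hmu : IsPartition n mu) {i j : ℕ} (hij : i ≤ j)
    (hj : j ≤ n) : hF n nu f i j = oct (star n n (mixed f)) n i j + starF n f 0 j := by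
  rw [hF, dint_condL (hf.star_mixed_nonneg hmu) hij (by omega) hj, hf.tint_rev hj, hf.tint_hyp]
  ring

/-! ### The commuter -/

theorem star_diag (p : ℕ → ℝ) {i j : ℕ} (hi : i ≤ n) (hj : j ≤ n) :
    star n n (diag p) i j = if i = j then rev n p i else 0 := by
  simp only [star, diag, rev]
  split_ifs <;> first | rfl | omega

theorem dint_star_diag (p : ℕ → ℝ) {x y : ℕ} (hx : x ≤ n) (hy : y ≤ n) :
    dint (star n n (diag p)) x y = tint (rev n p) (min x y) := by
  induction x with
  | zero => rw [dint_zero_left, Nat.zero_min, tint_zero]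
  | succ x ih =>
    have h : tint (star n n (diag p) (x + 1)) y = if x + 1 ≤ y then rev n p (x + 1) else 0 := by
      have h1 : tint (star n n (diag p) (x + 1)) y =
          ∑ l ∈ Finset.Icc 1 y, if x + 1 = l then rev n p (x + 1) else 0 :=
        Finset.sum_congr rfl fun l hl => star_diag p hx ((Finset.mem_Icc.1 hl).2.trans hy)
      rw [h1, Finset.sum_ite_eq]
      simp
    rw [dint_succ_left, ih (by omega), h]
    split_ifs with h1
    · rw [min_eq_left h1, min_eq_left (by omega), tint_succ]
    · rw [min_eq_right (by omega), min_eq_right (by omega), add_zero]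

/-- The reversed tuple increases, so the reversed diagonal array is tight to the right and
`oct_of_tight_right` applies. -/
theorem dint_condL_diag_succ (hlam : IsPartition n lam) {k z : ℕ} (hkz : k ≤ z) (hz : z < n) :
    dint (condL n n (star n n (diag lam))) (k + 1) (z + 1) =
      dint (condL n n (star n n (diag lam))) k z + rev n lam (z + 1) := by
  have h0 : ∀ i j, 1 ≤ i → i ≤ n → 1 ≤ j → j ≤ n → 0 ≤ star n n (diag lam) i j := by
    intro i j hi hin hj hjn
    rw [star_diag lam hin hjn]
    split_ifs
    · exact hlam.2 _ (by omega) (by omega)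
    · exact le_rfl
  have h1 : ∀ x y, x ≤ n → y ≤ n →
      dint (transp (star n n (diag lam))) x y = tint (rev n lam) (min x y) := fun x y hx hy => by
    rw [dint_transp, dint_star_diag lam hy hx, min_comm]
  rw [dint_condL h0 (by omega) (by omega) hz, dint_condL h0 hkz (by omega) hz.le,
    ← oct_transp h0 (by omega) (by omega) le_rfl hz, ← oct_transp h0 (by omega) hkz le_rfl hz.le]
  refine oct_of_tight_right (a := transp (star n n (diag lam)))
    (fun i j a b c d => h0 j i c d a b) (fun x hx => ?_) (fun x y hx hy => ?_) hkz hz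
  · rw [h1 _ _ hx le_rfl, h1 _ _ hx.le le_rfl, min_eq_left (Nat.succ_le_of_lt hx),
      min_eq_left hx.le, tint_succ]
  · rw [h1 _ _ hx hy, h1 _ _ (by omega) hy, h1 _ _ (by omega) hy.le, h1 _ _ (by omega) hy.le]
    rcases Nat.lt_or_ge x y with h | h
    · rw [min_eq_left (by omega), min_eq_left (by omega), min_eq_left (by omega),
        min_eq_left (by omega), tint_succ _ (x + 1), tint_succ _ x]
      linarith
    · rw [min_eq_right (by omega), min_eq_right (by omega), min_eq_right (by omega),
        min_eq_right (by omega)]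
      have := hlam.1 (n + 1 - (x + 2)) (by omega) (by omega)
      rw [show n + 1 - (x + 2) + 1 = n + 1 - (x + 1) by omega] at this
      simp only [rev]
      linarith

theorem IsDC.dint_condL_diag (hf : IsDC n lam mu nu f) (hlam : IsPartition n lam) {k z : ℕ}
    (hz : z + k ≤ n) : dint (condL n n (star n n (diag lam))) k (z + k) =
      starF n f n z - starF n f n (z + k) := by
  induction k with
  | zero => rw [dint_zero_left, add_zero, sub_self]
  | succ k ih =>
    have := hf.left (n - (z + k + 1)) (by omega)
    rw [show n - (z + k + 1) + 1 = n - (z + k) by omega] at this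
    rw [← add_assoc, dint_condL_diag_succ hlam (by omega) (by omega), ih (by omega), rev,
      show n + 1 - (z + k + 1) = n - (z + k) by omega, ← this,
      starF_of_le f (show z + k ≤ n by omega), starF_of_le f (show z + k + 1 ≤ n by omega),
      Nat.sub_self]
    ring

/-- The array `*(a ⊗ b)` of the anti-standard pair of a discrete concave function. -/
noncomputable def pairArray (n : ℕ) (lam : ℕ → ℝ) (f : ℕ → ℕ → ℝ) : ℕ → ℕ → ℝ :=
  star (2 * n) n (concat n (condR n n (diag lam)) (mixed f))

theorem pairArray_left {i j : ℕ} (hi : i ≤ n) :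
    pairArray n lam f i j = star n n (mixed f) i j := by
  simp only [pairArray, star, concat]
  rw [if_neg (by omega), show 2 * n + 1 - i - n = n + 1 - i by omega]

theorem pairArray_right {i j : ℕ} (hi : 1 ≤ i) (hin : i ≤ n) (hj : 1 ≤ j) (hjn : j ≤ n) :
    pairArray n lam f (n + i) j = condL n n (star n n (diag lam)) i j := by
  simp only [pairArray, star, concat, condR]
  rw [if_pos (by omega), show n + 1 - (2 * n + 1 - (n + i)) = i by omega,
    show n + 1 - (n + 1 - j) = j by omega]

theorem dint_pairArray_left {x z : ℕ} (hx : x ≤ n) :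
    dint (pairArray n lam f) x z = dint (star n n (mixed f)) x z :=
  Finset.sum_congr rfl fun _ hi => Finset.sum_congr rfl fun _ _ =>
    pairArray_left ((Finset.mem_Icc.1 hi).2.trans hx)

theorem dint_pairArray {k z : ℕ} (hk : k ≤ n) (hz : z ≤ n) :
    dint (pairArray n lam f) (n + k) z =
      dint (star n n (mixed f)) n z + dint (condL n n (star n n (diag lam))) k z := by
  induction k with
  | zero => rw [dint_zero_left, add_zero, add_zero, dint_pairArray_left le_rfl]
  | succ k ih =>
    rw [← add_assoc, dint_succ_left, dint_succ_left, ih (by omega), add_assoc]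
    congr 2
    refine Finset.sum_congr rfl fun j hj => ?_
    rw [Finset.mem_Icc] at hj
    exact pairArray_right (by omega) hk hj.1 (hj.2.trans hz)

/-- Transport along `(1,1,1)`: the boundary values come from the explicit mass of 𝐋(`*diag(λ)`), and
inside the first candidate of the maximum always wins. -/
theorem IsDC.oct_pairArray (hf : IsDC n lam mu nu f) (hlam : IsPartition n lam)
    (hmu : IsPartition n mu) (hnu : IsPartition n nu) {k y z : ℕ} (hyz : y ≤ z)
    (hz : z + k ≤ n) : oct (pairArray n lam f) (n + k) (y + k) (z + k) =
      oct (star n n (mixed f)) n y z + starF n f 0 z - starF n f 0 (z + k) := by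
  induction k generalizing y z with
  | zero =>
    rw [add_zero, add_zero, add_zero, add_sub_cancel_right]
    exact oct_congr (fun _ _ _ h _ _ => pairArray_left h) le_rfl hyz hz
  | succ k ihk =>
    induction z generalizing y with
    | zero =>
      obtain rfl : y = 0 := by omega
      have h1 := hf.dint_condL_diag hlam hz
      rw [oct_of_le _ le_rfl, oct_of_le _ le_rfl, dint_pairArray (by omega) hz, h1,
        dint_star_mixed f le_rfl hz, dint_zero_right]
      ring
    | succ z ihz =>
      induction hyz using Nat.decreasingInduction with
      | self =>
        rw [oct_of_le _ le_rfl, oct_of_le _ le_rfl, dint_pairArray (by omega) hz,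
          hf.dint_condL_diag hlam hz, dint_star_mixed f le_rfl hz,
          dint_star_mixed f le_rfl (by omega)]
        ring
      | of_succ y hy ih =>
        have h1 := ihk (show y ≤ z + 1 by omega) (by omega)
        have h2 := ihz (show y ≤ z by omega) (by omega)
        have h3 := ihk (show y + 1 ≤ z + 2 by omega) (by omega)
        have h4 := ihk (show y + 1 ≤ z + 1 by omega) (by omega)
        -- After substituting the induction hypotheses, this is exactly the comparison of the two
        -- candidates.
        have h5 := hf.oct_slope hmu hnu (show y ≤ z by omega) (by omega)
        have h6 := oct_rec (pairArray n lam f) (n + k) (show y + k + 1 ≤ z + 1 + k by omega)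
        simp only [show y + 1 + (k + 1) = y + k + 2 by omega,
          show z + 1 + (k + 1) = z + 1 + k + 1 by omega, ← add_assoc] at ih ⊢
        simp only [show y + 1 + k = y + k + 1 by omega, show z + 2 + k = z + 1 + k + 1 by omega]
          at h3 h4
        simp only [show z + (k + 1) = z + 1 + k by omega, ← add_assoc] at h2
        rw [h6, h1, h2, h3, h4, ih, max_eq_left (by linarith)]
        ring

end DC

end OctArray

theorem proposition4 (n : ℕ) (lam mu nu : ℕ → ℝ)
    (hlam : OctArray.IsPartition n lam) (hmu : OctArray.IsPartition n mu)
    (hnu : OctArray.IsPartition n nu)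
    (f : ℕ → ℕ → ℝ) (hf : OctArray.IsDC n lam mu nu f) :
    (∃ (F : ℕ → ℕ → ℕ → ℝ) (c : ℝ),
      -- on the quarter: `F` is the propagation of `*f` from the face `OB'C'`
      OctArray.IsQuarterOR n F ∧
      (∀ i j, j ≤ i → i ≤ n → F i j j = OctArray.starF n f i j) ∧
      -- it is the only one
      (∀ F' : ℕ → ℕ → ℕ → ℝ, OctArray.IsQuarterOR n F' →
        (∀ i j, j ≤ i → i ≤ n → F' i j j = OctArray.starF n f i j) →
        ∀ x y z, y ≤ z → z ≤ x → x ≤ n → F' x y z = F x y z) ∧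
      -- it is the restriction of the propagation of `*f` in the whole prism
      (∃ G : ℕ → ℕ → ℕ → ℝ, OctArray.IsPrismOR n G ∧
        (∀ i j, i ≤ n → j ≤ n → G i j j = OctArray.starF n f i j) ∧
        (∀ y z, y ≤ z → z ≤ n → G 0 y z = OctArray.starF n f 0 z) ∧
        ∀ x y z, y ≤ z → z ≤ x → x ≤ n → G x y z = F x y z) ∧
      -- its values on the face `C'D'B'` are `h` up to a constant
      ∀ i j, i ≤ j → j ≤ n → OctArray.hF n nu f i j = F n i j + c) ∧
    (∀ i j, i ≤ j → j ≤ n →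
      OctArray.hF n nu f i j = OctArray.comF n lam f (n - j) (n - j + i)) := by
  have hdiag : ∀ i j, j ≤ i → i ≤ n → OctArray.prism n f i j j = OctArray.starF n f i j :=
    fun i j hj hi => OctArray.prism_diag n f hi (hj.trans hi)
  refine ⟨⟨OctArray.prism n f, OctArray.starF n f 0 0 - OctArray.starF n f n 0,
    hf.isQuarterOR_prism hmu, hdiag, ?_, ?_, ?_⟩, ?_⟩
  · intro F' hF' h0 x y z hyz hzx hx
    exact hF'.unique (hf.isQuarterOR_prism hmu)
      (fun i j hj hi => (h0 i j hj hi).trans (hdiag i j hj hi).symm) hyz hzx hx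
  · refine ⟨OctArray.prism n f, OctArray.isPrismOR_prism n f,
      fun i j hi hj => OctArray.prism_diag n f hi hj, fun y z _ _ => ?_, fun _ _ _ _ _ _ => rfl⟩
    rw [OctArray.prism, OctArray.oct_zero_left]
    ring
  · intro i j hij hj
    rw [hf.hF_eq hmu hij hj, OctArray.prism]
    ring
  · intro i j hij hj
    -- The shift by `n - j` brings height `z = j` to `z = n`, where `oct` is the condensation 𝐃.
    have h := hf.oct_pairArray hlam hmu hnu (k := n - j) hij (by omega)
    have h0 : OctArray.starF n f 0 n = 0 := by
      rw [OctArray.starF_of_ge f (Nat.zero_le n), Nat.sub_self, hf.zero]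
    rw [show j + (n - j) = n by omega, h0, sub_zero] at h
    rw [hf.hF_eq hmu hij hj, ← h, add_comm i]
    exact (OctArray.dint_condD (2 * n) n _ (by omega) _).symm
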